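/- Let $\mathcal G$ be a connected metric graph with finitely many vertices and edges, where every edge is identified either with a bounded interval $[0,|e|]$, $|e|>0$, or with a half-line $[0,+\infty)$ (loops and multiple edges are allowed, and the end $+\infty$ of each half-line is a point at infinity of its own, which is not counted among the vertices). Let $H^1(\mathcal G)$ be the space of continuous real functions $u$ on $\mathcal G$ with $u|_e\in H^1(e)$ for every edge $e$. If $\mathcal G$ is non-compact, its critical mass is $\mu_{\mathcal G}=\sqrt{3/K_{\mathcal G}}$, where $K_{\mathcal G}$ is the best constant in the Gagliardo–Nirenberg inequality $$\int_{\mathcal G}|u|^6\le K_{\mathcal G}\Big(\int_{\mathcal G}|u|^2\Big)^2\int_{\mathcal G}|u'|^2\qquad\text{for all } u\in H^1(\mathcal G);$$ in particular this defines $\mu_{\mathbb R^+}$ for the half-line $\mathbb R^+=[0,+\infty)$. Suppose that 1. $\mathcal G$ has no terminal point, i.e. no vertex (not at infinity) of degree $1$; 2. $\mathcal G$ has no cycle covering, i.e. it is not true that every edge, bounded or not, belongs to a cycle, where a cycle is either a bounded loop (a non-trivial closed path of bounded edges which runs through no edge twice) or an unbounded path which runs through no edge twice and joins two distinct points at infinity;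 3. $\mathcal G$ has at least two half-lines. Then $\mu_{\mathcal G}>\mu_{\mathbb R^+}$. -/

import Mathlib

open MeasureTheory Set

noncomputable section

/-- A metric graph with vertex set `V` (vertices at infinity not included), set of bounded edges
`B` and set of half-lines `H`. The bounded edge `e` is a copy of `[0, len e]`, glued to the vertex
`src e` at `0` and to `tgt e` at `len e`; the half-line `h` is a copy of `[0, ∞)`, glued to the
vertex `origin h` at `0`. Loops and multiple edges are allowed. -/
structure MetricGraph (V B H : Type*) where
  /-- length of a bounded edge -/
  len : B → ℝ
  len_pos : ∀ e, 0 < len e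
  /-- vertex at the coordinate `0` of a bounded edge -/
  src : B → V
  /-- vertex at the coordinate `len e` of the bounded edge `e` -/
  tgt : B → V
  /-- vertex at the coordinate `0` of a half-line -/
  origin : H → V

/-- `f` belongs to `H¹(I)`, for an interval `I` which is `[0, L]` or `[0, ∞)`: it is (locally)
absolutely continuous on `I`, and both `f` and its a.e. derivative are square integrable. -/
def MemH1 (I : Set ℝ) (f : ℝ → ℝ) : Prop :=
  (∀ T ∈ I, AbsolutelyContinuousOnInterval f 0 T) ∧
    MemLp f 2 (volume.restrict I) ∧ MemLp (deriv f) 2 (volume.restrict I)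

namespace MetricGraph

variable {V B H : Type*}

/-- The half-line `ℝ⁺ = [0, ∞)` as a metric graph: one vertex and one half-line. -/
def halfLine : MetricGraph Unit Empty Unit where
  len := Empty.elim
  len_pos := fun e => e.elim
  src := Empty.elim
  tgt := Empty.elim
  origin := fun _ => ()

/-! ### Topology of the graph -/

/-- The graph is connected: any two vertices are joined by a path of bounded edges. -/
def Connected (G : MetricGraph V B H) : Prop :=
  (SimpleGraph.fromRel fun v w => ∃ e, G.src e = v ∧ G.tgt e = w).Connected

/-- First vertex of an oriented bounded edge; `(e, true)` is run from `src e` to `tgt e`, and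
`(e, false)` from `tgt e` to `src e`. -/
def tail (G : MetricGraph V B H) : B × Bool → V
  | (e, true) => G.src e
  | (e, false) => G.tgt e

/-- Last vertex of an oriented bounded edge. -/
def head (G : MetricGraph V B H) : B × Bool → V
  | (e, true) => G.tgt e
  | (e, false) => G.src e

/-- Degree of a vertex: the number of ends of edges at `v` (a loop counts twice). -/
def degree (G : MetricGraph V B H) (v : V) : ℕ :=
  Nat.card {d : B × Bool // G.tail d = v} + Nat.card {h : H // G.origin h = v}

/-- `v` is a terminal point (tip): a vertex, not at infinity, of degree one. -/
def IsTerminal (G : MetricGraph V B H) (v : V) : Prop :=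
  G.degree v = 1

/-- The list of consecutive oriented bounded edges is a walk from `v` to `w`. -/
def IsWalk (G : MetricGraph V B H) : V → List (B × Bool) → V → Prop
  | v, [], w => v = w
  | v, d :: l, w => G.tail d = v ∧ G.IsWalk (G.head d) l w

/-- A path of bounded edges from `v` to `w` which runs through no edge twice. -/
def IsPath (G : MetricGraph V B H) (v : V) (l : List (B × Bool)) (w : V) : Prop :=
  G.IsWalk v l w ∧ (l.map Prod.fst).Nodup

/-- The set of edges `C` is a cycle: either a bounded loop (a nontrivial closed path of bounded
edges) or an unbounded path joining two distinct points at infinity. -/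
def IsCycle (G : MetricGraph V B H) (C : Set (B ⊕ H)) : Prop :=
  (∃ v l, l ≠ [] ∧ G.IsPath v l v ∧ C = {e | ∃ d ∈ l, e = Sum.inl d.1}) ∨
    ∃ h h' l, h ≠ h' ∧ G.IsPath (G.origin h) l (G.origin h') ∧
      C = {e | e = Sum.inr h ∨ e = Sum.inr h' ∨ ∃ d ∈ l, e = Sum.inl d.1}

/-- The graph admits a cycle covering: every edge, bounded or not, belongs to a cycle. -/
def HasCycleCovering (G : MetricGraph V B H) : Prop :=
  ∀ e : B ⊕ H, ∃ C, G.IsCycle C ∧ e ∈ C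

/-! ### Functions on the graph and the critical mass -/

/-- The interval of coordinates of an edge. -/
def interval (G : MetricGraph V B H) : B ⊕ H → Set ℝ
  | Sum.inl e => Icc 0 (G.len e)
  | Sum.inr _ => Ici 0

/-- The space `H¹(G)` of the continuous functions on `G` whose restriction to every edge `e`
belongs to `H¹(e)`. A function is given by its restrictions `u e`, as functions of the coordinate
of the edge; continuity on `G` means that the restrictions, which are continuous on their edges,
take a common value `c v` at every vertex `v`. -/
def MemH1 (G : MetricGraph V B H) (u : B ⊕ H → ℝ → ℝ) : Prop :=
  (∀ e, _root_.MemH1 (G.interval e) (u e)) ∧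
    ∃ c : V → ℝ,
      (∀ e : B, u (Sum.inl e) 0 = c (G.src e) ∧ u (Sum.inl e) (G.len e) = c (G.tgt e)) ∧
        ∀ h : H, u (Sum.inr h) 0 = c (G.origin h)

/-- The integral over `G` of a function given by its restrictions to the edges. -/
def integral [Fintype B] [Fintype H] (G : MetricGraph V B H) (w : B ⊕ H → ℝ → ℝ) : ℝ :=
  ∑ e, ∫ x in G.interval e, w e x

/-- The best constant `K` in the Gagliardo–Nirenberg inequality
`∫ |u|⁶ ≤ K (∫ |u|²)² ∫ |u'|²` for `u ∈ H¹(G)`. -/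
def gnConstant [Fintype B] [Fintype H] (G : MetricGraph V B H) : ℝ :=
  sInf {K : ℝ | 0 ≤ K ∧ ∀ u, G.MemH1 u →
    G.integral (fun e x => |u e x| ^ 6) ≤
      K * G.integral (fun e x => |u e x| ^ 2) ^ 2 * G.integral (fun e x => |deriv (u e) x| ^ 2)}

/-- The critical mass `μ_G`, related to the best constant by `K = 3 / μ_G ^ 2`. -/
def criticalMass [Fintype B] [Fintype H] (G : MetricGraph V B H) : ℝ :=
  Real.sqrt (3 / G.gnConstant)

end MetricGraph

end

/-!
The critical mass of the half-line is `√3 π / 4`, and the point is that on `G` the energy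
`∫ u'² - ∫ u⁶ / 3` stays nonnegative up to a mass `μ > √3 π / 4` (`MetricGraph.exists_mass_gt`); by
homogeneity, `3 / μ ^ 2` is then admissible in the Gagliardo–Nirenberg inequality on `G`, while
`3 / (√3 π / 4) ^ 2` cannot be improved on the half-line, because of the half-soliton
(`MetricGraph.le_gnConstant_halfLine`). No compactness argument is involved.

Let `A s = ∫₀ˢ √(1 - r²) dr`, so that `A 1 = π / 4`. If `|u| ≤ N`, completing the square gives
`u'² + (N⁴ u² - u⁶) / 3 ≥ (N⁴ / √3) |(A (u² / N²))'|`. Call the integral of the left-hand side the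
action of `u` with amplitude `N`. A path on which `|u|` goes from its maximum `M` down to `0` at
infinity has action at least `(N⁴ / √3) A (M² / N²)`. With `N = M`, such a path gives
`∫ u'² - ∫ u⁶ / 3 ≥ (M⁴ / 3) (√3 π / 4 - ∫ u²)`, which is the sharp inequality on the half-line.

On `G`, a uniform excess of the action over this bound is needed.
* If the maximum is attained on a half-line, two disjoint paths lead to infinity
  (`MetricGraph.two_mul_discArea_le_sum_edgeAction`).
* If it is attained on a bounded edge, one path leads to infinity, and some half-line `h'` is disjoint
  from it (`MetricGraph.exists_discArea_add_le_sum_edgeAction`). If `|u| ≥ M / 2` at the origin of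
  `h'`, the action on `h'` is the excess. Otherwise `|u|` drops from `M` to `M / 2` on the compact
  part of the graph, hence `∫ u'²` is at least a constant times `M²`
  (`MetricGraph.sq_le_sum_integral_deriv_sq`), which exceeds `∫ u⁶ ≤ M⁴ ∫ u²` if `M` is small.
* There remain the large values of `M`. As there are no terminal points, the maximum point is also
  left by a second path, of length bounded below and disjoint from the first one
  (`MetricGraph.exists_escape`). If `|u|` drops below `M / 2` there, this is an excess of action.
  Otherwise the second path carries a definite part of the mass, and it pays to use an amplitude
  `N > M`: the bound for the first path loses only `O((N - M) ^ (3 / 2))`, and the second path gains a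
  term of order `N - M` (`MetricGraph.discArea_add_le_sum_edgeAction_or`,
  `MetricGraph.le_sqrt_three_mul_discArea_add`).

Disjointness of paths is that of sets of edges; for a set of edges joining two vertices, the increment
of a function between them is bounded by its variation on the set
(`MetricGraph.JoinedBy.abs_sub_le_sum`).
-/

open Filter Topology

/-! ### The area under the unit circle -/

/-- The area `∫₀ˢ √(1 - r²) dr` under the unit circle. Up to scaling, `discArea (u ^ 2 / N ^ 2)` is
the primitive that turns the action of `u` into a total variation. -/
noncomputable def discArea (s : ℝ) : ℝ := ∫ r in (0 : ℝ)..s, √(1 - r ^ 2)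

lemma continuous_sqrt_one_sub_sq : Continuous fun r : ℝ => √(1 - r ^ 2) := by fun_prop

lemma sqrt_one_sub_sq_le_one (r : ℝ) : √(1 - r ^ 2) ≤ 1 :=
  Real.sqrt_le_iff.2 ⟨zero_le_one, by nlinarith [sq_nonneg r]⟩

lemma hasDerivAt_discArea (s : ℝ) : HasDerivAt discArea √(1 - s ^ 2) s :=
  (continuous_sqrt_one_sub_sq.integral_hasStrictDerivAt 0 s).hasDerivAt

lemma continuous_discArea : Continuous discArea :=
  continuous_iff_continuousAt.2 fun s => (hasDerivAt_discArea s).continuousAt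

@[simp] lemma discArea_zero : discArea 0 = 0 := by simp [discArea]

lemma discArea_sub (s t : ℝ) : discArea t - discArea s = ∫ r in s..t, √(1 - r ^ 2) := by
  unfold discArea
  rw [intervalIntegral.integral_interval_sub_left] <;>
    exact continuous_sqrt_one_sub_sq.intervalIntegrable _ _

lemma discArea_mono : Monotone discArea := by
  intro s t h
  have := discArea_sub s t
  have h2 : 0 ≤ ∫ r in s..t, √(1 - r ^ 2) :=
    intervalIntegral.integral_nonneg h fun _ _ => Real.sqrt_nonneg _
  linarith

lemma abs_discArea_sub_le (s t : ℝ) : |discArea t - discArea s| ≤ |t - s| := by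
  rw [discArea_sub, ← Real.norm_eq_abs]
  have := intervalIntegral.norm_integral_le_of_norm_le_const (a := s) (b := t) (C := 1)
    (f := fun r : ℝ => √(1 - r ^ 2)) fun x _ => by
      rw [Real.norm_of_nonneg (Real.sqrt_nonneg _)]
      exact sqrt_one_sub_sq_le_one x
  simpa using this

lemma discArea_one : discArea 1 = Real.pi / 4 := by
  have h := integral_sqrt_one_sub_sq
  rw [← discArea_sub] at h
  have h2 : discArea (-1) = -discArea 1 := by
    have := intervalIntegral.integral_comp_neg (a := (0 : ℝ)) (b := 1)
      fun r : ℝ => √(1 - r ^ 2)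
    simp only [even_two.neg_pow, neg_zero] at this
    unfold discArea
    rw [this, intervalIntegral.integral_symm]
  linarith

lemma discArea_one_sub_le {r : ℝ} (h0 : 0 ≤ r) (h1 : r ≤ 1) :
    discArea 1 - discArea r ≤ (1 - r) * √(1 - r ^ 2) := by
  rw [discArea_sub]
  have : ∫ x in r..1, √(1 - x ^ 2) ≤ ∫ _ in r..1, √(1 - r ^ 2) := by
    refine intervalIntegral.integral_mono_on h1 (continuous_sqrt_one_sub_sq.intervalIntegrable _ _)
      (by simp) fun x hx => Real.sqrt_le_sqrt ?_
    nlinarith [hx.1]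
  simpa using this

lemma le_discArea_quarter : 1 / 8 ≤ discArea (1 / 4) := by
  have : ∫ _ in (0 : ℝ)..(1 / 4), (1 / 2 : ℝ) ≤ ∫ x in (0 : ℝ)..(1 / 4), √(1 - x ^ 2) := by
    refine intervalIntegral.integral_mono_on (by norm_num) (by simp)
      (continuous_sqrt_one_sub_sq.intervalIntegrable _ _) fun x hx => Real.le_sqrt_of_sq_le ?_
    nlinarith [hx.1, hx.2]
  unfold discArea
  refine le_trans ?_ this
  norm_num

lemma discArea_quarter_le : discArea (1 / 4) ≤ discArea 1 - 1 / 2 := by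
  have h := abs_discArea_sub_le 0 (1 / 4)
  rw [discArea_zero, sub_zero, sub_zero, abs_of_pos (by norm_num : (0 : ℝ) < 1 / 4)] at h
  have h2 := le_abs_self (discArea (1 / 4))
  rw [discArea_one]
  linarith [Real.pi_gt_three]

/-! ### The action on an interval -/

/-- The density `u'² + (N⁴ u² - u⁶) / 3` of the action of `u` with amplitude `N`. It is nonnegative
as long as `|u| ≤ N`; among the functions on the half-line which decrease from `N` to `0`, the
half-solitons of height `N` minimize its integral. -/
noncomputable def actionDensity (N : ℝ) (u : ℝ → ℝ) (x : ℝ) : ℝ :=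
  deriv u x ^ 2 + (N ^ 4 * u x ^ 2 - u x ^ 6) / 3

lemma sub_mul_sq_le_actionDensity {M N : ℝ} {u : ℝ → ℝ} {x : ℝ} (h : |u x| ≤ M) :
    (N ^ 4 - M ^ 4) / 3 * u x ^ 2 ≤ actionDensity N u x := by
  have h4 : u x ^ 4 ≤ M ^ 4 := by
    have := pow_le_pow_left₀ (abs_nonneg _) h 4
    rwa [Even.pow_abs (by decide)] at this
  have := mul_le_mul_of_nonneg_right h4 (sq_nonneg (u x))
  unfold actionDensity
  nlinarith [sq_nonneg (deriv u x)]

lemma actionDensity_nonneg {N : ℝ} {u : ℝ → ℝ} {x : ℝ} (h : |u x| ≤ N) :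
    0 ≤ actionDensity N u x := by
  simpa using sub_mul_sq_le_actionDensity (N := N) h

/-- Completing the square: the action density dominates the derivative of
`discArea (u ^ 2 / N ^ 2)`, up to the factor `N ^ 4 / √3`. -/
lemma abs_deriv_discArea_le {N : ℝ} (hN : 0 < N) {y d : ℝ} (h : |y| ≤ N) :
    N ^ 4 / √3 * |√(1 - (y ^ 2 / N ^ 2) ^ 2) * (2 * y * d / N ^ 2)| ≤
      d ^ 2 + (N ^ 4 * y ^ 2 - y ^ 6) / 3 := by
  have h2 : y ^ 2 ≤ N ^ 2 := sq_le_sq' (by linarith [(abs_le.1 h).1]) (abs_le.1 h).2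
  have hr : (y ^ 2 / N ^ 2) ^ 2 ≤ 1 := by
    have : y ^ 2 / N ^ 2 ≤ 1 := (div_le_one (by positivity)).2 h2
    exact pow_le_one₀ (by positivity) this
  have h3 : (0 : ℝ) < √3 := by positivity
  set R := √(1 - (y ^ 2 / N ^ 2) ^ 2) with hR
  have hRsq : R ^ 2 = 1 - (y ^ 2 / N ^ 2) ^ 2 := Real.sq_sqrt (by linarith)
  have h3sq : (√3 : ℝ) ^ 2 = 3 := Real.sq_sqrt (by norm_num)
  have hR0 : 0 ≤ R := Real.sqrt_nonneg _
  have e1 : N ^ 4 / √3 * |R * (2 * y * d / N ^ 2)| = 2 * |d| * (N ^ 2 * |y| * R / √3) := by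
    rw [abs_mul, abs_div, abs_mul, abs_mul, abs_of_nonneg hR0, abs_of_pos (by positivity : 0 < N ^ 2),
      abs_two]
    field_simp
  have e2 : (N ^ 4 * y ^ 2 - y ^ 6) / 3 = (N ^ 2 * |y| * R / √3) ^ 2 := by
    rw [div_pow, mul_pow, mul_pow, sq_abs, hRsq, h3sq]
    field_simp
  rw [e1, e2, ← sq_abs d]
  nlinarith [sq_nonneg (|d| - N ^ 2 * |y| * R / √3)]

/-- On a bounded interval, the action is at least the increment of `discArea (u ^ 2 / N ^ 2)`. -/
lemma abs_discArea_sub_le_setIntegral_actionDensity {N : ℝ} (hN : 0 < N) {u : ℝ → ℝ} {a b : ℝ}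
    (hab : a ≤ b) (hac : AbsolutelyContinuousOnInterval u a b) (hu : ∀ x ∈ Icc a b, |u x| ≤ N)
    (hint : IntegrableOn (actionDensity N u) (Icc a b)) :
    N ^ 4 / √3 * |discArea (u b ^ 2 / N ^ 2) - discArea (u a ^ 2 / N ^ 2)| ≤
      ∫ x in Icc a b, actionDensity N u x := by
  set y : ℝ → ℝ := fun x => discArea (u x ^ 2 / N ^ 2) with hy
  have hsq : AbsolutelyContinuousOnInterval (fun x => u x ^ 2 / N ^ 2) a b := by
    have := (hac.fun_mul hac).const_mul (1 / N ^ 2)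
    convert this using 2 with x
    ring
  have hyac : AbsolutelyContinuousOnInterval y a b := by
    refine squeeze_zero (fun t => Finset.sum_nonneg fun i _ => dist_nonneg) (fun t => ?_) hsq
    refine Finset.sum_le_sum fun i _ => ?_
    simp only [Real.dist_eq, hy]
    exact abs_discArea_sub_le _ _
  have hFTC := hyac.integral_deriv_eq_sub
  have hder : ∀ᵐ x, x ∈ uIcc a b →
      N ^ 4 / √3 * |deriv y x| ≤ actionDensity N u x := by
    filter_upwards [hac.ae_differentiableAt] with x hx hxab
    have hd := (hx hxab).hasDerivAt
    have h1 : HasDerivAt (fun x => u x ^ 2 / N ^ 2) (2 * u x * deriv u x / N ^ 2) x := by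
      have := (hd.pow 2).div_const (N ^ 2)
      convert! this using 1
      simp
    have h2 : HasDerivAt y (√(1 - (u x ^ 2 / N ^ 2) ^ 2) * (2 * u x * deriv u x / N ^ 2)) x :=
      HasDerivAt.comp x (h₂ := discArea) (hasDerivAt_discArea (u x ^ 2 / N ^ 2)) h1
    rw [h2.deriv]
    exact abs_deriv_discArea_le hN (hu x (by rwa [uIcc_of_le hab] at hxab))
  have hk : 0 ≤ N ^ 4 / √3 := by positivity
  have hint' : IntervalIntegrable (actionDensity N u) volume a b := by
    rw [intervalIntegrable_iff_integrableOn_Icc_of_le hab]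
    exact hint
  rw [← hFTC, integral_Icc_eq_integral_Ioc, ← intervalIntegral.integral_of_le hab]
  calc N ^ 4 / √3 * |∫ x in a..b, deriv y x|
      ≤ N ^ 4 / √3 * ∫ x in a..b, |deriv y x| := by
        gcongr
        exact intervalIntegral.abs_integral_le_integral_abs hab
    _ = ∫ x in a..b, N ^ 4 / √3 * |deriv y x| := by
        rw [intervalIntegral.integral_const_mul]
    _ ≤ _ := by
        refine intervalIntegral.integral_mono_ae_restrict hab
          (hyac.intervalIntegrable_deriv.abs.const_mul _) hint' ?_
        rw [Filter.EventuallyLE, ae_restrict_iff' measurableSet_Icc]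
        rwa [uIcc_of_le hab] at hder

namespace MemH1

lemma absolutelyContinuousOnInterval {I : Set ℝ} {u : ℝ → ℝ} (h : MemH1 I u) {a b : ℝ}
    (ha : 0 ≤ a) (hab : a ≤ b) (hb : b ∈ I) : AbsolutelyContinuousOnInterval u a b := by
  refine (h.1 b hb).mono ?_
  rw [uIcc_of_le hab, uIcc_of_le (ha.trans hab)]
  exact Icc_subset_Icc_left ha

lemma integrableOn_deriv_sq {I : Set ℝ} {u : ℝ → ℝ} (h : MemH1 I u) :
    IntegrableOn (fun x => deriv u x ^ 2) I :=
  h.2.2.integrable_sq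

lemma integrableOn_sq {I : Set ℝ} {u : ℝ → ℝ} (h : MemH1 I u) :
    IntegrableOn (fun x => u x ^ 2) I :=
  h.2.1.integrable_sq

lemma integrableOn_pow_six {I : Set ℝ} (hI : MeasurableSet I) {u : ℝ → ℝ} (h : MemH1 I u) {M : ℝ}
    (hM : ∀ x ∈ I, |u x| ≤ M) : IntegrableOn (fun x => u x ^ 6) I := by
  refine (h.integrableOn_sq.const_mul (M ^ 4)).mono' (h.2.1.1.pow 6) ?_
  rw [ae_restrict_iff' hI]
  refine ae_of_all _ fun x hx => ?_
  have h4 := pow_le_pow_left₀ (abs_nonneg _) (hM x hx) 4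
  rw [Even.pow_abs (by decide)] at h4
  rw [Real.norm_of_nonneg (by positivity)]
  calc u x ^ 6 = u x ^ 4 * u x ^ 2 := by ring
    _ ≤ _ := by gcongr

lemma integrableOn_actionDensity {I : Set ℝ} (hI : MeasurableSet I) {u : ℝ → ℝ} (h : MemH1 I u)
    {M : ℝ} (hM : ∀ x ∈ I, |u x| ≤ M) (N : ℝ) : IntegrableOn (actionDensity N u) I :=
  h.integrableOn_deriv_sq.add
    (((h.integrableOn_sq.const_mul (N ^ 4)).sub (h.integrableOn_pow_six hI hM)).div_const 3)

lemma tendsto_atTop {u : ℝ → ℝ} (h : MemH1 (Ici 0) u) : Tendsto u atTop (𝓝 0) := by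
  have hint : IntegrableOn (fun x => deriv u x * u x + u x * deriv u x) (Ioi 0) := by
    have : IntegrableOn (fun x => deriv u x * u x) (Ici 0) := h.2.2.integrable_mul h.2.1
    have h2 := this.add this
    refine IntegrableOn.mono_set (h2.congr_fun (fun x _ => ?_) measurableSet_Ici) Ioi_subset_Ici_self
    simp only [Pi.add_apply]
    ring
  have hlim := intervalIntegral_tendsto_integral_Ioi 0 hint tendsto_id
  -- `u ^ 2` is a primitive of the integrable function `2 u u'`, hence it has a limit
  obtain ⟨l, hl⟩ : ∃ l, Tendsto (fun x => u x ^ 2) atTop (𝓝 l) := by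
    refine ⟨(∫ x in Ioi 0, deriv u x * u x + u x * deriv u x) + u 0 ^ 2,
      (hlim.add_const (u 0 ^ 2)).congr' ?_⟩
    filter_upwards [eventually_ge_atTop 0] with T hT
    have hac := h.1 T hT
    rw [id, hac.integral_deriv_mul_eq_sub hac]
    ring
  have hl0 : l = 0 := by
    by_contra hne
    have hl1 : 0 < l := lt_of_le_of_ne (ge_of_tendsto' hl fun x => sq_nonneg _) (Ne.symm hne)
    obtain ⟨T, hT⟩ := eventually_atTop.1 (hl.eventually_const_lt (half_lt_self hl1))
    have hconst : IntegrableOn (fun _ : ℝ => l / 2) (Ioi (max T 0)) := by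
      refine Integrable.mono' (h.integrableOn_sq.mono_set fun x hx => ?_)
        aestronglyMeasurable_const ?_
      · exact (le_max_right T 0).trans (le_of_lt hx)
      · rw [ae_restrict_iff' measurableSet_Ioi]
        refine ae_of_all _ fun x hx => ?_
        rw [Real.norm_of_nonneg (by positivity)]
        exact (hT x ((le_max_left T 0).trans (le_of_lt hx))).le
    rw [integrableOn_const_iff] at hconst
    simp [hl1.ne'] at hconst
  rw [hl0] at hl
  have := hl.sqrt
  simp only [Real.sqrt_sq_eq_abs, Real.sqrt_zero] at this
  exact (tendsto_zero_iff_abs_tendsto_zero _).2 this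

lemma continuousOn_Ici {u : ℝ → ℝ} (h : MemH1 (Ici 0) u) : ContinuousOn u (Ici 0) := by
  intro x hx
  have hx0 : (0 : ℝ) ≤ x := hx
  have hc := (h.1 (x + 1) (by simp only [mem_Ici]; linarith)).continuousOn
  rw [uIcc_of_le (by linarith)] at hc
  refine (hc x ⟨hx, by linarith⟩).mono_of_mem_nhdsWithin ?_
  rw [← Ici_inter_Iic]
  exact inter_mem self_mem_nhdsWithin (mem_nhdsWithin_of_mem_nhds (Iic_mem_nhds (by linarith)))

lemma setIntegral_Icc_le_Ici {N : ℝ} {u : ℝ → ℝ} (h : MemH1 (Ici 0) u)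
    (hu : ∀ x ∈ Ici 0, |u x| ≤ N) {a T : ℝ} (ha : 0 ≤ a) :
    ∫ x in Icc a T, actionDensity N u x ≤ ∫ x in Ici a, actionDensity N u x := by
  have hsub : Ici a ⊆ Ici 0 := Ici_subset_Ici.2 ha
  refine setIntegral_mono_set ((h.integrableOn_actionDensity measurableSet_Ici hu N).mono_set hsub)
    ?_ (ae_of_all _ Icc_subset_Ici_self)
  rw [Filter.EventuallyLE, ae_restrict_iff' measurableSet_Ici]
  exact ae_of_all _ fun x hx => actionDensity_nonneg (hu x (hsub hx))

/-- On a half-line, a function in `H¹` goes down to `0` at infinity. -/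
lemma discArea_le_setIntegral_Ici {N : ℝ} (hN : 0 < N) {u : ℝ → ℝ} (h : MemH1 (Ici 0) u)
    (hu : ∀ x ∈ Ici 0, |u x| ≤ N) {a : ℝ} (ha : 0 ≤ a) :
    N ^ 4 / √3 * discArea (u a ^ 2 / N ^ 2) ≤ ∫ x in Ici a, actionDensity N u x := by
  have hlim : Tendsto (fun T => N ^ 4 / √3 * (discArea (u a ^ 2 / N ^ 2) -
      discArea (u T ^ 2 / N ^ 2))) atTop (𝓝 (N ^ 4 / √3 * (discArea (u a ^ 2 / N ^ 2) -
        discArea (0 ^ 2 / N ^ 2)))) :=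
    ((((continuous_discArea.tendsto _).comp ((h.tendsto_atTop.pow 2).div_const _)).const_sub
      _).const_mul _)
  simp only [ne_eq, OfNat.ofNat_ne_zero, not_false_eq_true, zero_pow, zero_div, discArea_zero,
    sub_zero] at hlim
  refine le_of_tendsto hlim ?_
  filter_upwards [eventually_ge_atTop a] with T hT
  refine le_trans ?_ (h.setIntegral_Icc_le_Ici hu ha (T := T))
  have hsub : Icc a T ⊆ Ici 0 := fun x hx => ha.trans hx.1
  refine le_trans ?_ (abs_discArea_sub_le_setIntegral_actionDensity hN hT
    (h.absolutelyContinuousOnInterval ha hT (ha.trans hT)) (fun x hx => hu x (hsub hx))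
    ((h.integrableOn_actionDensity measurableSet_Ici hu N).mono_set hsub))
  gcongr
  rw [abs_sub_comm]
  exact le_abs_self _

end MemH1

lemma actionDensity_setIntegral_nonneg {N : ℝ} {u : ℝ → ℝ} {I : Set ℝ} (hI : MeasurableSet I)
    (hu : ∀ x ∈ I, |u x| ≤ N) : 0 ≤ ∫ x in I, actionDensity N u x :=
  setIntegral_nonneg hI fun x hx => actionDensity_nonneg (hu x hx)

/-- Where `u` stays above half of its maximum `M`, the action with an amplitude `N > M` exceeds the
action with amplitude `M`. -/
lemma le_setIntegral_actionDensity_of_le {M N : ℝ} (hMN : M ≤ N) (hM : 0 ≤ M) {u : ℝ → ℝ} {a b : ℝ}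
    (hab : a ≤ b) (hu : ∀ x ∈ Icc a b, |u x| ≤ M) (hlow : ∀ x ∈ Icc a b, M ^ 2 / 4 ≤ u x ^ 2)
    (hint : IntegrableOn (actionDensity N u) (Icc a b)) :
    (N ^ 4 - M ^ 4) / 3 * (M ^ 2 / 4) * (b - a) ≤ ∫ x in Icc a b, actionDensity N u x := by
  have hc : ∫ _ in Icc a b, (N ^ 4 - M ^ 4) / 3 * (M ^ 2 / 4) ≤
      ∫ x in Icc a b, actionDensity N u x := by
    refine setIntegral_mono_on (integrableOn_const (by simp)) hint measurableSet_Icc fun x hx => ?_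
    refine le_trans ?_ (sub_mul_sq_le_actionDensity (hu x hx))
    have : 0 ≤ (N ^ 4 - M ^ 4) / 3 := by
      have := pow_le_pow_left₀ hM hMN 4
      linarith
    exact mul_le_mul_of_nonneg_left (hlow x hx) this
  rw [setIntegral_const, smul_eq_mul, Real.volume_real_Icc_of_le hab] at hc
  linarith

namespace MetricGraph

variable {V B H : Type*}

/-! ### Paths of bounded edges -/

/-- The vertices `v` and `w` are joined by a path made of bounded edges of `T`. -/
def JoinedBy (G : MetricGraph V B H) (T : Finset B) : V → V → Prop :=
  Relation.ReflTransGen fun v w => ∃ d : B × Bool, d.1 ∈ T ∧ G.tail d = v ∧ G.head d = w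

lemma tail_flip (G : MetricGraph V B H) (e : B) (s : Bool) : G.tail (e, !s) = G.head (e, s) := by
  cases s <;> rfl

lemma head_flip (G : MetricGraph V B H) (e : B) (s : Bool) : G.head (e, !s) = G.tail (e, s) := by
  cases s <;> rfl

lemma JoinedBy.symm {G : MetricGraph V B H} {T : Finset B} {v w : V} (h : G.JoinedBy T v w) :
    G.JoinedBy T w v := by
  have : Std.Symm fun v w => ∃ d : B × Bool, d.1 ∈ T ∧ G.tail d = v ∧ G.head d = w := by
    refine ⟨?_⟩
    rintro a b ⟨⟨e, s⟩, he, h1, h2⟩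
    exact ⟨(e, !s), he, (G.tail_flip e s).trans h2, (G.head_flip e s).trans h1⟩
  exact Relation.ReflTransGen.stdSymm.symm _ _ h

lemma Connected.joinedBy_univ [Fintype B] {G : MetricGraph V B H} (hG : G.Connected) (v w : V) :
    G.JoinedBy Finset.univ v w := by
  have := (SimpleGraph.reachable_iff_reflTransGen v w).1 (hG.preconnected v w)
  refine Relation.ReflTransGen.mono (fun a b hab => ?_) v w this
  rw [SimpleGraph.fromRel_adj] at hab
  obtain ⟨-, ⟨e, h1, h2⟩ | ⟨e, h1, h2⟩⟩ := hab
  · exact ⟨(e, true), Finset.mem_univ _, h1, h2⟩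
  · exact ⟨(e, false), Finset.mem_univ _, h2, h1⟩

/-- If `w` bounds the increment of a vertex function `q` along each edge of `T`, then its sum over
`T` bounds the difference of the values of `q` at vertices joined by `T`. A path need not be
simple for this: every value between the two is taken on some edge of `T`, so that the ranges of
`q` on these edges cover the interval between the two values. -/
lemma JoinedBy.abs_sub_le_sum {G : MetricGraph V B H} {T : Finset B} {a b : V}
    (h : G.JoinedBy T a b) {q : V → ℝ} {w : B → ℝ}
    (hw : ∀ f ∈ T, |q (G.tgt f) - q (G.src f)| ≤ w f) :
    |q b - q a| ≤ ∑ f ∈ T, w f := by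
  have hcov : uIcc (q a) (q b) ⊆ {q a} ∪ ⋃ f ∈ T, uIcc (q (G.src f)) (q (G.tgt f)) := by
    induction h with
    | refl => simp
    | @tail c d _ hcd ih =>
      obtain ⟨⟨f, s⟩, hf, rfl, rfl⟩ := hcd
      refine (uIcc_subset_uIcc_union_uIcc (b := q (G.tail (f, s)))).trans (union_subset ih ?_)
      refine subset_union_of_subset_right ?_ _
      refine subset_trans ?_ (subset_biUnion_of_mem (u := fun f => uIcc (q (G.src f)) (q (G.tgt f)))
        hf)
      cases s
      · simp only [tail, head, uIcc_comm]; exact subset_rfl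
      · exact subset_rfl
  have hmeas : volume (uIcc (q a) (q b)) ≤ ∑ f ∈ T, ENNReal.ofReal (w f) := by
    calc volume (uIcc (q a) (q b))
        ≤ volume ({q a} ∪ ⋃ f ∈ T, uIcc (q (G.src f)) (q (G.tgt f))) := measure_mono hcov
      _ ≤ volume {q a} + volume (⋃ f ∈ T, uIcc (q (G.src f)) (q (G.tgt f))) := measure_union_le _ _
      _ ≤ 0 + ∑ f ∈ T, volume (uIcc (q (G.src f)) (q (G.tgt f))) := by
          gcongr
          · simp
          · exact measure_biUnion_finset_le _ _
      _ ≤ _ := by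
          rw [zero_add]
          gcongr with f hf
          rw [Real.volume_interval]
          exact ENNReal.ofReal_le_ofReal (hw f hf)
  have hw0 : ∀ f ∈ T, 0 ≤ w f := fun f hf => (abs_nonneg _).trans (hw f hf)
  rw [Real.volume_interval, ← ENNReal.ofReal_sum_of_nonneg hw0] at hmeas
  exact (ENNReal.ofReal_le_ofReal_iff (Finset.sum_nonneg hw0)).1 hmeas

/-- The edges of the component of `a` in the graph without `e` suffice to join `a` to the vertices
of that component; an edge outside the component is not among them. -/
lemma JoinedBy.exists_restrict [Fintype B] [DecidableEq B] {G : MetricGraph V B H} {e : B} {a w : V}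
    (h : G.JoinedBy (Finset.univ.erase e) a w) :
    ∃ T : Finset B, e ∉ T ∧ G.JoinedBy T a w ∧
      ∀ d : B × Bool, d.1 ∈ T → G.JoinedBy (Finset.univ.erase e) a (G.tail d) := by
  classical
  refine ⟨Finset.univ.filter fun f => f ≠ e ∧ G.JoinedBy (Finset.univ.erase e) a (G.src f),
    by simp, ?_, ?_⟩
  · induction h with
    | refl => exact Relation.ReflTransGen.refl
    | @tail c d hc hcd ih =>
      refine Relation.ReflTransGen.tail ih ?_
      obtain ⟨⟨f, s⟩, hf, rfl, rfl⟩ := hcd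
      refine ⟨(f, s), ?_, rfl, rfl⟩
      have hfe : f ≠ e := by simpa using hf
      simp only [Finset.mem_filter, Finset.mem_univ, true_and]
      refine ⟨hfe, ?_⟩
      cases s
      · exact Relation.ReflTransGen.tail hc ⟨(f, false), hf, rfl, rfl⟩
      · exact hc
  · rintro ⟨f, s⟩ hf
    simp only [Finset.mem_filter, Finset.mem_univ, true_and] at hf
    cases s
    · exact Relation.ReflTransGen.tail hf.2 ⟨(f, true), by simp [hf.1], rfl, rfl⟩
    · exact hf.2

/-- The two ways of leaving a point of the bounded edge `e`. Either one can escape to infinity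
through both ends of `e`, without using `e` again. Or one can escape through one end, while the
other end is left by a further edge `d`, as it is not a terminal point, and the escaping path does
not use `d`. -/
theorem exists_escape [Fintype B] [Finite H] [Nonempty H] {G : MetricGraph V B H}
    (hG : G.Connected) (htip : ∀ v, ¬ G.IsTerminal v) (e : B) :
    (∀ s : Bool, ∃ (T : Finset B) (h : H), e ∉ T ∧ G.JoinedBy T (G.tail (e, s)) (G.origin h)) ∨
      ∃ (s : Bool) (T : Finset B) (h : H) (d : B × Bool), e ∉ T ∧
        G.JoinedBy T (G.tail (e, s)) (G.origin h) ∧ d.1 ≠ e ∧ d.1 ∉ T ∧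
          G.tail d = G.head (e, s) := by
  classical
  -- every vertex lies in the component of one end of `e` once `e` is removed
  have hreach : ∀ w, ∃ s, G.JoinedBy (Finset.univ.erase e) (G.tail (e, s)) w := by
    intro w
    have := hG.joinedBy_univ (G.src e) w
    induction this with
    | refl => exact ⟨true, Relation.ReflTransGen.refl⟩
    | @tail c d _ hcd ih =>
      obtain ⟨⟨f, t⟩, -, rfl, rfl⟩ := hcd
      by_cases hfe : f = e
      · subst hfe
        exact ⟨!t, by rw [tail_flip]; exact Relation.ReflTransGen.refl⟩
      · obtain ⟨s, hs⟩ := ih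
        exact ⟨s, hs.tail ⟨(f, t), by simp [hfe], rfl, rfl⟩⟩
  obtain ⟨s, hs⟩ : ∃ s, ∃ h, G.JoinedBy (Finset.univ.erase e) (G.tail (e, s)) (G.origin h) := by
    obtain ⟨h⟩ := ‹Nonempty H›
    obtain ⟨s, hs⟩ := hreach (G.origin h)
    exact ⟨s, h, hs⟩
  by_cases hother : ∃ h, G.JoinedBy (Finset.univ.erase e) (G.tail (e, !s)) (G.origin h)
  · left
    intro t
    obtain ⟨h, ht⟩ : ∃ h, G.JoinedBy (Finset.univ.erase e) (G.tail (e, t)) (G.origin h) := by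
      rcases Bool.eq_or_eq_not t s with rfl | rfl
      exacts [hs, hother]
    obtain ⟨T, he, hT, -⟩ := ht.exists_restrict
    exact ⟨T, h, he, hT⟩
  · right
    push Not at hother
    obtain ⟨h, hs⟩ := hs
    obtain ⟨T, he, hT, hmem⟩ := hs.exists_restrict
    have hnj : ¬ G.JoinedBy (Finset.univ.erase e) (G.tail (e, s)) (G.tail (e, !s)) := fun hj =>
      hother h (Relation.ReflTransGen.trans hj.symm hs)
    have hemp : IsEmpty {h : H // G.origin h = G.tail (e, !s)} :=
      ⟨fun h' => hother h' (by rw [h'.2]; exact Relation.ReflTransGen.refl)⟩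
    have hdeg : Nat.card {d : B × Bool // G.tail d = G.tail (e, !s)} ≠ 1 := by
      have := htip (G.tail (e, !s))
      simpa [IsTerminal, degree] using this
    obtain ⟨d, hd, hde⟩ : ∃ d, G.tail d = G.tail (e, !s) ∧ d ≠ (e, !s) := by
      by_contra! hcon
      refine hdeg (Nat.card_eq_one_iff_unique.2 ⟨⟨fun x y => Subtype.ext ?_⟩, ⟨⟨_, rfl⟩⟩⟩)
      rw [hcon _ x.2, hcon _ y.2]
    have hd1 : d.1 ≠ e := by
      rintro h1
      obtain ⟨f, t⟩ := d
      obtain rfl : f = e := h1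
      rcases Bool.eq_or_eq_not t s with rfl | rfl
      · exact hnj (by rw [← hd]; exact Relation.ReflTransGen.refl)
      · exact hde rfl
    exact ⟨s, T, h, d, he, hT, hd1, fun hdT => hnj (hd ▸ hmem d hdT), by rw [hd, tail_flip]⟩

end MetricGraph

/-- The bound `abs_discArea_sub_le_setIntegral_actionDensity` for two points of an interval, in either
order. -/
lemma MemH1.abs_discArea_sub_le {I : Set ℝ} (hI : MeasurableSet I) {u : ℝ → ℝ} (h : MemH1 I u)
    {N : ℝ} (hN : 0 < N) (hu : ∀ x ∈ I, |u x| ≤ N) {a b : ℝ} (ha : 0 ≤ a) (hab : Icc a b ⊆ I)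
    {x y : ℝ} (hx : x ∈ Icc a b) (hy : y ∈ Icc a b) :
    N ^ 4 / √3 * |discArea (u x ^ 2 / N ^ 2) - discArea (u y ^ 2 / N ^ 2)| ≤
      ∫ z in Icc a b, actionDensity N u z := by
  wlog hxy : y ≤ x generalizing x y
  · rw [abs_sub_comm]
    exact this hy hx (by linarith)
  have hint := (h.integrableOn_actionDensity hI hu N).mono_set hab
  have hsub : Icc y x ⊆ Icc a b := Icc_subset_Icc hy.1 hx.2
  refine (abs_discArea_sub_le_setIntegral_actionDensity hN hxy
    (h.absolutelyContinuousOnInterval (ha.trans hy.1) hxy (hab hx))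
    (fun z hz => hu z (hab (hsub hz))) (hint.mono_set hsub)).trans ?_
  refine setIntegral_mono_set hint ?_ (ae_of_all _ hsub)
  rw [Filter.EventuallyLE, ae_restrict_iff' measurableSet_Icc]
  exact ae_of_all _ fun z hz => actionDensity_nonneg (hu z (hab hz))

lemma MemH1.abs_sub_le {I : Set ℝ} {u : ℝ → ℝ} (h : MemH1 I u) {a x : ℝ} (ha : 0 ≤ a)
    (hax : a ≤ x) {b : ℝ} (hxb : x ≤ b) (hb : b ∈ I) :
    |u x - u a| ≤ ∫ z in Icc a b, |deriv u z| := by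
  have hac := h.absolutelyContinuousOnInterval ha (hax.trans hxb) hb
  have hac' : AbsolutelyContinuousOnInterval u a x := by
    refine hac.mono ?_
    rw [uIcc_of_le hax, uIcc_of_le (hax.trans hxb)]
    exact Icc_subset_Icc_right hxb
  rw [← hac'.integral_deriv_eq_sub]
  refine (intervalIntegral.abs_integral_le_integral_abs hax).trans ?_
  rw [intervalIntegral.integral_of_le hax]
  have hint := hac.intervalIntegrable_deriv.abs
  rw [intervalIntegrable_iff_integrableOn_Icc_of_le (hax.trans hxb)] at hint
  refine setIntegral_mono_set hint (ae_of_all _ fun z => abs_nonneg _) (ae_of_all _ ?_)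
  exact Ioc_subset_Icc_self.trans (Icc_subset_Icc_right hxb)

namespace MetricGraph

variable {V B H : Type*}

/-! ### The action on a graph -/

lemma measurableSet_interval (G : MetricGraph V B H) (e : B ⊕ H) :
    MeasurableSet (G.interval e) := by
  cases e
  exacts [measurableSet_Icc, measurableSet_Ici]

/-- The action with amplitude `N` of the function `u` on the edge `e`. -/
noncomputable def edgeAction (G : MetricGraph V B H) (u : B ⊕ H → ℝ → ℝ) (N : ℝ) (e : B ⊕ H) : ℝ :=
  ∫ x in G.interval e, actionDensity N (u e) x

lemma sum_edgeAction [Fintype B] [Fintype H] {G : MetricGraph V B H} {u : B ⊕ H → ℝ → ℝ}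
    (hu : G.MemH1 u) {M : ℝ} (hM : ∀ e, ∀ x ∈ G.interval e, |u e x| ≤ M) (N : ℝ) :
    ∑ e, G.edgeAction u N e = G.integral (fun e x => |deriv (u e) x| ^ 2) +
      (N ^ 4 * G.integral (fun e x => |u e x| ^ 2) - G.integral (fun e x => |u e x| ^ 6)) / 3 := by
  simp only [integral, sq_abs, Even.pow_abs (n := 6) (by decide)]
  rw [Finset.mul_sum, ← Finset.sum_sub_distrib, Finset.sum_div, ← Finset.sum_add_distrib]
  refine Finset.sum_congr rfl fun e _ => ?_
  have h2 := (hu.1 e).integrableOn_sq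
  have h6 := (hu.1 e).integrableOn_pow_six (G.measurableSet_interval e) (hM e)
  have h3 : IntegrableOn (fun x => (N ^ 4 * u e x ^ 2 - u e x ^ 6) / 3) (G.interval e) :=
    ((h2.const_mul _).sub h6).div_const 3
  unfold edgeAction actionDensity
  rw [integral_add (hu.1 e).integrableOn_deriv_sq h3, integral_div,
    integral_sub (h2.const_mul _) h6, integral_const_mul]

/-- The part of the bounded edge `e` between the point of coordinate `x` and the first vertex of the
oriented edge `(e, s)`. -/
def piece (G : MetricGraph V B H) (e : B) (x : ℝ) : Bool → Set ℝ
  | true => Icc 0 x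
  | false => Icc x (G.len e)

section

variable {G : MetricGraph V B H} {u : B ⊕ H → ℝ → ℝ} {c : V → ℝ} {N : ℝ}

lemma edgeAction_nonneg (hN : ∀ e, ∀ x ∈ G.interval e, |u e x| ≤ N) (e : B ⊕ H) :
    0 ≤ G.edgeAction u N e :=
  actionDensity_setIntegral_nonneg (G.measurableSet_interval e) (hN e)

lemma exists_piece_eq_Icc {e : B} {x : ℝ} (hx : x ∈ Icc 0 (G.len e)) (s : Bool) :
    ∃ a b, G.piece e x s = Icc a b ∧ 0 ≤ a ∧ a ≤ b ∧ x ∈ Icc a b ∧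
      Icc a b ⊆ G.interval (Sum.inl e) := by
  cases s
  · exact ⟨x, G.len e, rfl, hx.1, hx.2, ⟨le_rfl, hx.2⟩, Icc_subset_Icc_left hx.1⟩
  · exact ⟨0, x, rfl, le_rfl, hx.1, ⟨hx.1, le_rfl⟩, Icc_subset_Icc_right hx.2⟩

lemma exists_mem_piece_eq
    (hc : ∀ e : B, u (Sum.inl e) 0 = c (G.src e) ∧ u (Sum.inl e) (G.len e) = c (G.tgt e))
    {e : B} {x : ℝ} (hx : x ∈ Icc 0 (G.len e)) (s : Bool) :
    ∃ y ∈ G.piece e x s, u (Sum.inl e) y = c (G.tail (e, s)) := by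
  cases s
  · exact ⟨_, ⟨hx.2, le_rfl⟩, (hc e).2⟩
  · exact ⟨_, ⟨le_rfl, hx.1⟩, (hc e).1⟩

lemma setIntegral_piece_add (hu : ∀ e, _root_.MemH1 (G.interval e) (u e))
    (hN : ∀ e, ∀ x ∈ G.interval e, |u e x| ≤ N) {e : B} {x : ℝ} (hx : x ∈ Icc 0 (G.len e))
    (s : Bool) :
    (∫ z in G.piece e x s, actionDensity N (u (Sum.inl e)) z) +
      ∫ z in G.piece e x (!s), actionDensity N (u (Sum.inl e)) z =
        G.edgeAction u N (Sum.inl e) := by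
  have hint : IntegrableOn _ (Icc 0 (G.len e)) := (hu (Sum.inl e)).integrableOn_actionDensity
    (G.measurableSet_interval _) (hN _) N
  have key : (∫ z in Icc 0 x, actionDensity N (u (Sum.inl e)) z) +
      ∫ z in Icc x (G.len e), actionDensity N (u (Sum.inl e)) z =
        G.edgeAction u N (Sum.inl e) := by
    change _ = ∫ z in Icc 0 (G.len e), actionDensity N (u (Sum.inl e)) z
    rw [integral_Icc_eq_integral_Ico, ← Ico_union_Icc_eq_Icc hx.1 hx.2, setIntegral_union]
    · exact Set.disjoint_left.2 fun z h1 h2 => absurd h1.2 (not_lt.2 h2.1)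
    · exact measurableSet_Icc
    · exact hint.mono_set (Ico_subset_Icc_self.trans (Icc_subset_Icc_right hx.2))
    · exact hint.mono_set (Icc_subset_Icc_left hx.1)
  cases s
  · rw [add_comm]; exact key
  · exact key

lemma setIntegral_piece_nonneg (hN : ∀ e, ∀ x ∈ G.interval e, |u e x| ≤ N) {e : B} {x : ℝ}
    (hx : x ∈ Icc 0 (G.len e)) (s : Bool) :
    0 ≤ ∫ z in G.piece e x s, actionDensity N (u (Sum.inl e)) z := by
  obtain ⟨a, b, h, -, -, -, hsub⟩ := G.exists_piece_eq_Icc hx s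
  rw [h]
  exact actionDensity_setIntegral_nonneg measurableSet_Icc fun z hz => hN _ z (hsub hz)

lemma discArea_sub_le_piece (hu : ∀ e, _root_.MemH1 (G.interval e) (u e)) (hN0 : 0 < N)
    (hN : ∀ e, ∀ x ∈ G.interval e, |u e x| ≤ N) {e : B} {x y : ℝ} (hx : x ∈ Icc 0 (G.len e))
    {s : Bool} (hy : y ∈ G.piece e x s) :
    N ^ 4 / √3 * |discArea (u (Sum.inl e) x ^ 2 / N ^ 2) -
      discArea (u (Sum.inl e) y ^ 2 / N ^ 2)| ≤
        ∫ z in G.piece e x s, actionDensity N (u (Sum.inl e)) z := by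
  obtain ⟨a, b, h, ha, -, hxab, hsub⟩ := G.exists_piece_eq_Icc hx s
  rw [h] at hy ⊢
  exact (hu _).abs_discArea_sub_le (G.measurableSet_interval _) hN0 (hN _) ha hsub hxab hy

lemma abs_discArea_sub_le_edgeAction (hu : ∀ e, _root_.MemH1 (G.interval e) (u e)) (hN0 : 0 < N)
    (hN : ∀ e, ∀ x ∈ G.interval e, |u e x| ≤ N) {e : B} {x y : ℝ} (hx : x ∈ Icc 0 (G.len e))
    (hy : y ∈ Icc 0 (G.len e)) :
    N ^ 4 / √3 * |discArea (u (Sum.inl e) x ^ 2 / N ^ 2) -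
      discArea (u (Sum.inl e) y ^ 2 / N ^ 2)| ≤ G.edgeAction u N (Sum.inl e) :=
  (hu (Sum.inl e)).abs_discArea_sub_le (G.measurableSet_interval _) hN0 (hN _) le_rfl subset_rfl
    hx hy

lemma discArea_le_edgeAction_inr (hu : ∀ e, _root_.MemH1 (G.interval e) (u e)) (hN0 : 0 < N)
    (hN : ∀ e, ∀ x ∈ G.interval e, |u e x| ≤ N)
    (hc : ∀ h : H, u (Sum.inr h) 0 = c (G.origin h)) (h : H) :
    N ^ 4 / √3 * discArea (c (G.origin h) ^ 2 / N ^ 2) ≤ G.edgeAction u N (Sum.inr h) := by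
  rw [← hc]
  exact (hu (Sum.inr h)).discArea_le_setIntegral_Ici hN0 (hN (Sum.inr h)) le_rfl

/-- Along a path of bounded edges, the action is at least the increment of
`discArea (u ^ 2 / N ^ 2)`. -/
lemma JoinedBy.discArea_sub_le (hu : ∀ e, _root_.MemH1 (G.interval e) (u e)) (hN0 : 0 < N)
    (hN : ∀ e, ∀ x ∈ G.interval e, |u e x| ≤ N)
    (hc : ∀ e : B, u (Sum.inl e) 0 = c (G.src e) ∧ u (Sum.inl e) (G.len e) = c (G.tgt e))
    {T : Finset B} {a b : V} (h : G.JoinedBy T a b) :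
    N ^ 4 / √3 * (discArea (c a ^ 2 / N ^ 2) - discArea (c b ^ 2 / N ^ 2)) ≤
      ∑ f ∈ T, G.edgeAction u N (Sum.inl f) := by
  have hk : 0 ≤ N ^ 4 / √3 := by positivity
  have := h.abs_sub_le_sum (q := fun v => N ^ 4 / √3 * discArea (c v ^ 2 / N ^ 2))
    (w := fun f => G.edgeAction u N (Sum.inl f)) fun f _ => by
      rw [← mul_sub, abs_mul, abs_of_nonneg hk, ← (hc f).1, ← (hc f).2]
      exact abs_discArea_sub_le_edgeAction hu hN0 hN ⟨(G.len_pos f).le, le_rfl⟩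
        ⟨le_rfl, (G.len_pos f).le⟩
  rw [← mul_sub, abs_mul, abs_of_nonneg hk, abs_sub_comm] at this
  exact le_trans (mul_le_mul_of_nonneg_left (le_abs_self _) hk) this

/-- A maximum point on a half-line is left by two disjoint paths to infinity, so that the action is
twice the one of a half-soliton. -/
theorem two_mul_discArea_le_sum_edgeAction [Fintype B] [Fintype H] (hG : G.Connected)
    (hH : 2 ≤ Fintype.card H) (hu : ∀ e, _root_.MemH1 (G.interval e) (u e)) (hN0 : 0 < N)
    (hN : ∀ e, ∀ x ∈ G.interval e, |u e x| ≤ N)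
    (hcB : ∀ e : B, u (Sum.inl e) 0 = c (G.src e) ∧ u (Sum.inl e) (G.len e) = c (G.tgt e))
    (hcH : ∀ h : H, u (Sum.inr h) 0 = c (G.origin h)) {h : H} {x : ℝ} (hx : 0 ≤ x) :
    N ^ 4 / √3 * (2 * discArea (u (Sum.inr h) x ^ 2 / N ^ 2)) ≤ ∑ e, G.edgeAction u N e := by
  classical
  obtain ⟨h', hh'⟩ : ∃ h', h' ≠ h := Fintype.exists_ne_of_one_lt_card hH h
  have hint : IntegrableOn _ (Ici (0 : ℝ)) := (hu (Sum.inr h)).integrableOn_actionDensity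
    (G.measurableSet_interval _) (hN _) N
  have hsplit : (∫ z in Icc 0 x, actionDensity N (u (Sum.inr h)) z) +
      ∫ z in Ici x, actionDensity N (u (Sum.inr h)) z = G.edgeAction u N (Sum.inr h) := by
    change _ = ∫ z in Ici 0, actionDensity N (u (Sum.inr h)) z
    rw [integral_Icc_eq_integral_Ico, ← Ico_union_Ici_eq_Ici hx, setIntegral_union]
    · exact Set.disjoint_left.2 fun z h1 h2 => absurd h1.2 (not_lt.2 h2)
    · exact measurableSet_Ici
    · exact hint.mono_set (Ico_subset_Icc_self.trans Icc_subset_Ici_self)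
    · exact hint.mono_set (Ici_subset_Ici.2 hx)
  have h1 := (hu (Sum.inr h)).discArea_le_setIntegral_Ici hN0 (hN (Sum.inr h)) hx
  have h2 := (hu (Sum.inr h)).abs_discArea_sub_le (G.measurableSet_interval _) hN0 (hN (Sum.inr h))
    le_rfl (a := 0) (b := x) (x := x) (y := 0) Icc_subset_Ici_self ⟨hx, le_rfl⟩ ⟨le_rfl, hx⟩
  have hk : 0 ≤ N ^ 4 / √3 := by positivity
  have h3 := (mul_le_mul_of_nonneg_left (le_abs_self _) hk).trans h2
  rw [hcH] at h3
  have h4 := (hG.joinedBy_univ (G.origin h) (G.origin h')).discArea_sub_le hu hN0 hN hcB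
  have h5 := discArea_le_edgeAction_inr hu hN0 hN hcH h'
  have h6 : G.edgeAction u N (Sum.inr h') + G.edgeAction u N (Sum.inr h) ≤
      ∑ h, G.edgeAction u N (Sum.inr h) := by
    rw [← Finset.sum_pair (f := fun h => G.edgeAction u N (Sum.inr h)) hh']
    exact Finset.sum_le_sum_of_subset_of_nonneg (Finset.subset_univ _)
      fun h _ _ => edgeAction_nonneg hN _
  rw [Fintype.sum_sum_type]
  linarith

/-- The action along a path to infinity which starts at the point of coordinate `x` of the bounded
edge `e`. -/
lemma discArea_le_of_joinedBy (hu : ∀ e, _root_.MemH1 (G.interval e) (u e)) (hN0 : 0 < N)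
    (hN : ∀ e, ∀ x ∈ G.interval e, |u e x| ≤ N)
    (hcB : ∀ e : B, u (Sum.inl e) 0 = c (G.src e) ∧ u (Sum.inl e) (G.len e) = c (G.tgt e))
    (hcH : ∀ h : H, u (Sum.inr h) 0 = c (G.origin h)) {e : B} {x : ℝ} (hx : x ∈ Icc 0 (G.len e))
    {s : Bool} {T : Finset B} {h : H} (hT : G.JoinedBy T (G.tail (e, s)) (G.origin h)) :
    N ^ 4 / √3 * discArea (u (Sum.inl e) x ^ 2 / N ^ 2) ≤
      (∫ z in G.piece e x s, actionDensity N (u (Sum.inl e)) z) +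
        ∑ f ∈ T, G.edgeAction u N (Sum.inl f) + G.edgeAction u N (Sum.inr h) := by
  obtain ⟨y, hy, hyc⟩ := exists_mem_piece_eq hcB hx s
  have hk : 0 ≤ N ^ 4 / √3 := by positivity
  have h1 := (mul_le_mul_of_nonneg_left (le_abs_self _) hk).trans
    (discArea_sub_le_piece hu hN0 hN hx hy)
  rw [hyc] at h1
  have h2 := hT.discArea_sub_le hu hN0 hN hcB
  have h3 := discArea_le_edgeAction_inr hu hN0 hN hcH h
  linarith

/-- A path to infinity and a disjoint half-line. -/
theorem exists_discArea_add_le_sum_edgeAction [Fintype B] [Fintype H] (hG : G.Connected)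
    (htip : ∀ v, ¬ G.IsTerminal v) (hH : 2 ≤ Fintype.card H)
    (hu : ∀ e, _root_.MemH1 (G.interval e) (u e)) (hN0 : 0 < N)
    (hN : ∀ e, ∀ x ∈ G.interval e, |u e x| ≤ N)
    (hcB : ∀ e : B, u (Sum.inl e) 0 = c (G.src e) ∧ u (Sum.inl e) (G.len e) = c (G.tgt e))
    (hcH : ∀ h : H, u (Sum.inr h) 0 = c (G.origin h)) {e : B} {x : ℝ}
    (hx : x ∈ Icc 0 (G.len e)) :
    ∃ h' : H, N ^ 4 / √3 * (discArea (u (Sum.inl e) x ^ 2 / N ^ 2) +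
      discArea (c (G.origin h') ^ 2 / N ^ 2)) ≤ ∑ e, G.edgeAction u N e := by
  classical
  have : Nonempty H := Fintype.card_pos_iff.1 (by omega)
  obtain ⟨s, T, h, he, hT⟩ : ∃ (s : Bool) (T : Finset B) (h : H), e ∉ T ∧
      G.JoinedBy T (G.tail (e, s)) (G.origin h) := by
    rcases exists_escape hG htip e with hs | ⟨s, T, h, -, he, hT, -⟩
    · exact ⟨true, hs true⟩
    · exact ⟨s, T, h, he, hT⟩
  obtain ⟨h', hh'⟩ : ∃ h', h' ≠ h := Fintype.exists_ne_of_one_lt_card hH h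
  refine ⟨h', ?_⟩
  have h1 := discArea_le_of_joinedBy hu hN0 hN hcB hcH hx hT
  have h2 := discArea_le_edgeAction_inr hu hN0 hN hcH h'
  have h3 := setIntegral_piece_add hu hN hx s
  have h4 := setIntegral_piece_nonneg hN hx (!s)
  have h5 : G.edgeAction u N (Sum.inr h') + G.edgeAction u N (Sum.inr h) ≤
      ∑ h, G.edgeAction u N (Sum.inr h) := by
    rw [← Finset.sum_pair (f := fun h => G.edgeAction u N (Sum.inr h)) hh']
    exact Finset.sum_le_sum_of_subset_of_nonneg (Finset.subset_univ _)
      fun h _ _ => edgeAction_nonneg hN _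
  have h6 : G.edgeAction u N (Sum.inl e) + ∑ f ∈ T, G.edgeAction u N (Sum.inl f) ≤
      ∑ f, G.edgeAction u N (Sum.inl f) := by
    rw [← Finset.sum_insert (f := fun f => G.edgeAction u N (Sum.inl f)) he]
    exact Finset.sum_le_sum_of_subset_of_nonneg (Finset.subset_univ _)
      fun f _ _ => edgeAction_nonneg hN _
  rw [Fintype.sum_sum_type]
  linarith

/-- Besides a path to infinity, a maximum point on a bounded edge is left by a disjoint path whose
length is bounded below. On that path, either `u` drops below half of its maximum, which increases
the action, or it carries a definite mass. -/
theorem discArea_add_le_sum_edgeAction_or [Fintype B] [Fintype H] (hG : G.Connected)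
    (htip : ∀ v, ¬ G.IsTerminal v) [Nonempty H]
    (hu : ∀ e, _root_.MemH1 (G.interval e) (u e)) {M : ℝ} (hM0 : 0 < M)
    (hM : ∀ e, ∀ x ∈ G.interval e, |u e x| ≤ M)
    (hcB : ∀ e : B, u (Sum.inl e) 0 = c (G.src e) ∧ u (Sum.inl e) (G.len e) = c (G.tgt e))
    (hcH : ∀ h : H, u (Sum.inr h) 0 = c (G.origin h)) {δ : ℝ} (hδ : 0 < δ)
    (hδlen : ∀ f, δ ≤ G.len f) {e : B} {x : ℝ} (hx : x ∈ Icc 0 (G.len e))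
    (hxM : |u (Sum.inl e) x| = M) :
    M ^ 4 / √3 * (discArea 1 + 1 / 2) ≤ ∑ e, G.edgeAction u M e ∨
      ∀ N, M ≤ N → N ^ 4 / √3 * discArea (M ^ 2 / N ^ 2) +
        (N ^ 4 - M ^ 4) / 3 * (M ^ 2 / 4) * (δ / 2) ≤ ∑ e, G.edgeAction u N e := by
  classical
  obtain ⟨s, T, h, he, hT, hs⟩ : ∃ (s : Bool) (T : Finset B) (h : H), e ∉ T ∧
      G.JoinedBy T (G.tail (e, s)) (G.origin h) ∧
      ((∃ a b, G.piece e x (!s) = Icc a b ∧ δ / 2 ≤ b - a) ∨ ∃ d : B × Bool, d.1 ≠ e ∧ d.1 ∉ T ∧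
        G.tail d = G.head (e, s)) := by
    rcases exists_escape hG htip e with hs | ⟨s, T, h, d, he, hT, hd⟩
    · -- run to infinity through the shorter part of `e`
      rcases le_total x (G.len e / 2) with h2 | h2
      · obtain ⟨T, h, he, hT⟩ := hs true
        exact ⟨true, T, h, he, hT, Or.inl ⟨x, G.len e, rfl, by linarith [hδlen e]⟩⟩
      · obtain ⟨T, h, he, hT⟩ := hs false
        exact ⟨false, T, h, he, hT, Or.inl ⟨0, x, rfl, by linarith [hδlen e]⟩⟩
    · exact ⟨s, T, h, he, hT, Or.inr ⟨d, hd⟩⟩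
  have hNof : ∀ N, M ≤ N → ∀ e, ∀ x ∈ G.interval e, |u e x| ≤ N :=
    fun N hMN e x hx => (hM e x hx).trans hMN
  have hsq : u (Sum.inl e) x ^ 2 = M ^ 2 := by rw [← hxM, sq_abs]
  have hpath : ∀ N, M ≤ N → N ^ 4 / √3 * discArea (M ^ 2 / N ^ 2) ≤
      (∫ z in G.piece e x s, actionDensity N (u (Sum.inl e)) z) +
        ∑ f ∈ T, G.edgeAction u N (Sum.inl f) + ∑ h, G.edgeAction u N (Sum.inr h) := by
    intro N hMN
    have h1 := discArea_le_of_joinedBy hu (hM0.trans_le hMN) (hNof N hMN) hcB hcH hx hT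
    rw [hsq] at h1
    have h2 : G.edgeAction u N (Sum.inr h) ≤ ∑ h, G.edgeAction u N (Sum.inr h) :=
      Finset.single_le_sum (f := fun h => G.edgeAction u N (Sum.inr h))
        (fun h _ => edgeAction_nonneg (hNof N hMN) _) (Finset.mem_univ h)
    linarith
  have hsum : ∀ N, M ≤ N → G.edgeAction u N (Sum.inl e) + ∑ f ∈ T, G.edgeAction u N (Sum.inl f) ≤
      ∑ f, G.edgeAction u N (Sum.inl f) := by
    intro N hMN
    rw [← Finset.sum_insert (f := fun f => G.edgeAction u N (Sum.inl f)) he]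
    exact Finset.sum_le_sum_of_subset_of_nonneg (Finset.subset_univ _)
      fun f _ _ => edgeAction_nonneg (hNof N hMN) _
  have hk : 0 ≤ M ^ 4 / √3 := by positivity
  have hM1 : M ^ 2 / M ^ 2 = 1 := div_self (by positivity)
  -- a value below `M / 2` costs at least `discArea 1 - discArea (1 / 4)`
  have hlow : ∀ y : ℝ, y ^ 2 < M ^ 2 / 4 →
      M ^ 4 / √3 * discArea (y ^ 2 / M ^ 2) ≤ M ^ 4 / √3 * (discArea 1 - 1 / 2) := by
    intro y hy
    refine mul_le_mul_of_nonneg_left ((discArea_mono ?_).trans discArea_quarter_le) hk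
    rw [div_le_iff₀ (by positivity)]
    linarith
  have hpM := hpath M le_rfl
  rw [hM1] at hpM
  simp only [Fintype.sum_sum_type]
  by_cases hdip : ∃ y ∈ G.piece e x (!s), u (Sum.inl e) y ^ 2 < M ^ 2 / 4
  · left
    obtain ⟨y, hy, hyM⟩ := hdip
    have h1 := (mul_le_mul_of_nonneg_left (le_abs_self _) hk).trans
      (discArea_sub_le_piece hu hM0 hM hx hy)
    rw [hsq, hM1] at h1
    linarith [hlow _ hyM, hsum M le_rfl, setIntegral_piece_add hu hM hx s]
  push Not at hdip
  rcases hs with ⟨a, b, hab, hlen⟩ | ⟨d, hde, hdT, hd⟩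
  · right
    intro N hMN
    rw [hab] at hdip
    obtain ⟨a', b', h, -, -, -, hsub⟩ := G.exists_piece_eq_Icc hx (!s)
    rw [← h, hab] at hsub
    have h1 := le_setIntegral_actionDensity_of_le hMN hM0.le (by linarith)
      (fun z hz => hM (Sum.inl e) z (hsub hz)) hdip
      (((hu _).integrableOn_actionDensity (G.measurableSet_interval _) (hM _) N).mono_set hsub)
    have h2 := setIntegral_piece_add hu (hNof N hMN) hx s
    rw [hab] at h2
    have h3 : (N ^ 4 - M ^ 4) / 3 * (M ^ 2 / 4) * (δ / 2) ≤
        (N ^ 4 - M ^ 4) / 3 * (M ^ 2 / 4) * (b - a) := by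
      have : 0 ≤ N ^ 4 - M ^ 4 := by linarith [pow_le_pow_left₀ hM0.le hMN 4]
      gcongr
    linarith [hpath N hMN, hsum N hMN]
  · have hsum' : ∀ N, M ≤ N → G.edgeAction u N (Sum.inl d.1) + (G.edgeAction u N (Sum.inl e) +
        ∑ f ∈ T, G.edgeAction u N (Sum.inl f)) ≤ ∑ f, G.edgeAction u N (Sum.inl f) := by
      intro N hMN
      rw [← Finset.sum_insert (f := fun f => G.edgeAction u N (Sum.inl f)) he,
        ← Finset.sum_insert (f := fun f => G.edgeAction u N (Sum.inl f)) (by simp [hde, hdT])]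
      exact Finset.sum_le_sum_of_subset_of_nonneg (Finset.subset_univ _)
        fun f _ _ => edgeAction_nonneg (hNof N hMN) _
    by_cases hdip' : ∃ y ∈ Icc 0 (G.len d.1), u (Sum.inl d.1) y ^ 2 < M ^ 2 / 4
    · left
      obtain ⟨y, hy, hyM⟩ := hdip'
      obtain ⟨z, hz, hzc⟩ := exists_mem_piece_eq hcB hx (!s)
      have h1 := (mul_le_mul_of_nonneg_left (le_abs_self _) hk).trans
        (discArea_sub_le_piece hu hM0 hM hx hz)
      obtain ⟨w, hw, hwc⟩ := exists_mem_piece_eq hcB hy d.2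
      obtain ⟨a, b, hab, -, -, -, hsub⟩ := G.exists_piece_eq_Icc hy d.2
      have h2 := (mul_le_mul_of_nonneg_left (le_abs_self _) hk).trans
        (abs_discArea_sub_le_edgeAction hu hM0 hM (hsub (hab ▸ hw)) hy)
      rw [hzc, tail_flip, hsq, hM1] at h1
      rw [hwc, hd] at h2
      linarith [hlow _ hyM, hsum' M le_rfl, setIntegral_piece_add hu hM hx s]
    · right
      intro N hMN
      push Not at hdip'
      have h1 := le_setIntegral_actionDensity_of_le hMN hM0.le (G.len_pos d.1).le
        (hM (Sum.inl d.1)) hdip'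
        ((hu _).integrableOn_actionDensity (G.measurableSet_interval (Sum.inl d.1)) (hM _) N)
      have h3 : (N ^ 4 - M ^ 4) / 3 * (M ^ 2 / 4) * (δ / 2) ≤
          (N ^ 4 - M ^ 4) / 3 * (M ^ 2 / 4) * (G.len d.1 - 0) := by
        have : 0 ≤ N ^ 4 - M ^ 4 := by linarith [pow_le_pow_left₀ hM0.le hMN 4]
        have := hδlen d.1
        gcongr
        linarith
      have h4 : G.edgeAction u N (Sum.inl d.1) =
        ∫ z in Icc 0 (G.len d.1), actionDensity N (u (Sum.inl d.1)) z := rfl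
      linarith [hpath N hMN, hsum' N hMN, setIntegral_piece_add hu (hNof N hMN) hx s,
        setIntegral_piece_nonneg (hNof N hMN) hx (!s)]

/-- If `u` drops from `M` on a bounded edge to `M / 2` at some vertex, then its Dirichlet integral on
the compact part of the graph is bounded below. -/
theorem sq_le_sum_integral_deriv_sq [Fintype B] (hG : G.Connected)
    (hu : ∀ e, _root_.MemH1 (G.interval e) (u e))
    (hcB : ∀ e : B, u (Sum.inl e) 0 = c (G.src e) ∧ u (Sum.inl e) (G.len e) = c (G.tgt e))
    {M : ℝ} {e : B} {x : ℝ} (hx : x ∈ Icc 0 (G.len e))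
    (hxM : |u (Sum.inl e) x| = M) {v : V} (hv : |c v| ≤ M / 2) :
    M ^ 2 ≤ 16 * (∑ f, G.len f) * ∑ f, ∫ x in Icc 0 (G.len f), deriv (u (Sum.inl f)) x ^ 2 := by
  set w : B → ℝ := fun f => ∫ x in Icc 0 (G.len f), |deriv (u (Sum.inl f)) x| with hw
  set L := ∑ f, G.len f with hL
  have hL0 : 0 < L := Finset.sum_pos (fun f _ => G.len_pos f) ⟨e, Finset.mem_univ e⟩
  have hw0 : ∀ f, 0 ≤ w f := fun f => setIntegral_nonneg measurableSet_Icc fun _ _ => abs_nonneg _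
  have hM0 : 0 ≤ M := hxM ▸ abs_nonneg _
  have h1 : |u (Sum.inl e) x - u (Sum.inl e) 0| ≤ w e :=
    (hu (Sum.inl e)).abs_sub_le le_rfl hx.1 hx.2 ⟨(G.len_pos e).le, le_rfl⟩
  have h2 : |c v - c (G.src e)| ≤ ∑ f, w f :=
    (hG.joinedBy_univ (G.src e) v).abs_sub_le_sum fun f _ => by
      rw [← (hcB f).1, ← (hcB f).2]
      exact (hu (Sum.inl f)).abs_sub_le le_rfl (G.len_pos f).le le_rfl ⟨(G.len_pos f).le, le_rfl⟩
  have h3 : w e ≤ ∑ f, w f := Finset.single_le_sum (fun f _ => hw0 f) (Finset.mem_univ e)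
  have h4 : M / 4 ≤ ∑ f, w f := by
    rw [(hcB e).1] at h1
    have h5 : |u (Sum.inl e) x| ≤ |u (Sum.inl e) x - c (G.src e)| + |c v - c (G.src e)| + |c v| := by
      have := abs_add_three (u (Sum.inl e) x - c (G.src e)) (-(c v - c (G.src e))) (c v)
      rw [abs_neg] at this
      refine le_trans (le_of_eq ?_) this
      congr 1
      ring
    linarith
  set k := M / (4 * L) with hk
  have h6 : ∀ f, 2 * k * w f - k ^ 2 * G.len f ≤
      ∫ x in Icc 0 (G.len f), deriv (u (Sum.inl f)) x ^ 2 := by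
    intro f
    have hint2 : IntegrableOn _ (Icc 0 (G.len f)) := (hu (Sum.inl f)).integrableOn_deriv_sq
    have hint1 : IntegrableOn (fun x => |deriv (u (Sum.inl f)) x|) (Icc 0 (G.len f)) := by
      have := ((hu (Sum.inl f)).absolutelyContinuousOnInterval le_rfl (G.len_pos f).le
        ⟨(G.len_pos f).le, le_rfl⟩).intervalIntegrable_deriv.abs
      rwa [intervalIntegrable_iff_integrableOn_Icc_of_le (G.len_pos f).le] at this
    have hc : IntegrableOn (fun _ : ℝ => k ^ 2) (Icc 0 (G.len f)) :=
      integrableOn_const (by simp)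
    have h7 : ∫ x in Icc 0 (G.len f), (2 * k * |deriv (u (Sum.inl f)) x| - k ^ 2) ≤
        ∫ x in Icc 0 (G.len f), deriv (u (Sum.inl f)) x ^ 2 := by
      refine setIntegral_mono_on ((hint1.const_mul _).sub hc) hint2 measurableSet_Icc fun x _ => ?_
      rw [← sq_abs (deriv (u (Sum.inl f)) x)]
      nlinarith [sq_nonneg (|deriv (u (Sum.inl f)) x| - k)]
    rw [integral_sub (hint1.const_mul _) hc, integral_const_mul, setIntegral_const,
      Real.volume_real_Icc_of_le (G.len_pos f).le, smul_eq_mul] at h7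
    linarith
  have h8 := Finset.sum_le_sum fun f (_ : f ∈ Finset.univ) => h6 f
  rw [Finset.sum_sub_distrib, ← Finset.mul_sum, ← Finset.mul_sum, ← hL] at h8
  have hk0 : 0 ≤ k := by positivity
  have h9 : 2 * k * (M / 4) ≤ 2 * k * ∑ f, w f := by gcongr
  have h10 : 16 * L * (2 * k * (M / 4) - k ^ 2 * L) = M ^ 2 := by
    rw [hk]
    field_simp
    ring
  rw [← h10]
  gcongr
  linarith

end

end MetricGraph

/-! ### Maximum points -/

lemma MemH1.exists_isMaxOn_abs_Ici {u : ℝ → ℝ} (h : MemH1 (Ici 0) u) :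
    ∃ x ∈ Ici (0 : ℝ), IsMaxOn (fun x => |u x|) (Ici 0) x := by
  by_cases hzero : ∀ x ∈ Ici (0 : ℝ), u x = 0
  · refine ⟨0, self_mem_Ici, fun x hx => ?_⟩
    simp [hzero x hx, hzero 0 self_mem_Ici]
  push Not at hzero
  obtain ⟨y, hy, hy0⟩ := hzero
  obtain ⟨T, hT⟩ := eventually_atTop.1
    ((tendsto_zero_iff_abs_tendsto_zero _).1 h.tendsto_atTop |>.eventually_lt_const
      (abs_pos.2 hy0))
  have hyT : y ∈ Icc 0 (max T y) := ⟨hy, le_max_right _ _⟩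
  obtain ⟨x, hx, hmax⟩ := isCompact_Icc.exists_isMaxOn ⟨y, hyT⟩
    ((h.continuousOn_Ici.mono Icc_subset_Ici_self).abs)
  refine ⟨x, hx.1, fun z hz => ?_⟩
  rcases le_total z (max T y) with hzT | hzT
  · exact hmax ⟨hz, hzT⟩
  · exact (hT z ((le_max_left _ _).trans hzT)).le.trans (hmax hyT)

namespace MetricGraph

variable {V B H : Type*}

/-- A function in `H¹` attains the maximum of its modulus. -/
lemma MemH1.exists_max [Finite B] [Finite H] [Nonempty (B ⊕ H)] {G : MetricGraph V B H}
    {u : B ⊕ H → ℝ → ℝ} (hu : G.MemH1 u) :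
    ∃ e₀, ∃ x₀ ∈ G.interval e₀, ∀ e, ∀ x ∈ G.interval e, |u e x| ≤ |u e₀ x₀| := by
  have hedge : ∀ e, ∃ x ∈ G.interval e, IsMaxOn (fun x => |u e x|) (G.interval e) x := by
    rintro (e | h)
    · have h0 : (0 : ℝ) ≤ G.len e := (G.len_pos e).le
      have hc := ((hu.1 (Sum.inl e)).absolutelyContinuousOnInterval le_rfl h0
        ⟨h0, le_rfl⟩).continuousOn
      rw [uIcc_of_le h0] at hc
      exact isCompact_Icc.exists_isMaxOn ⟨0, le_rfl, h0⟩ hc.abs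
    · exact _root_.MemH1.exists_isMaxOn_abs_Ici (hu.1 (Sum.inr h))
  choose x hx hmax using hedge
  obtain ⟨e₀, he₀⟩ := Finite.exists_max fun e => |u e (x e)|
  exact ⟨e₀, x e₀, hx e₀, fun e y hy => (hmax e hy).trans (he₀ e)⟩

lemma MemH1.const_mul {G : MetricGraph V B H} {u : B ⊕ H → ℝ → ℝ} (hu : G.MemH1 u) (a : ℝ) : G.MemH1 fun e x => a * u e x := by
  obtain ⟨h1, c, hB, hH⟩ := hu
  refine ⟨fun e => ⟨fun T hT => ((h1 e).1 T hT).const_mul a, (h1 e).2.1.const_mul a, ?_⟩,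
    fun v => a * c v, fun e => ?_, fun h => congrArg (a * ·) (hH h)⟩
  · have : deriv (fun x => a * u e x) = fun x => a * deriv (u e) x :=
      funext fun x => deriv_const_mul_field _
    rw [this]
    exact (h1 e).2.2.const_mul a
  · exact ⟨congrArg (a * ·) (hB e).1, congrArg (a * ·) (hB e).2⟩

/-! ### The subcritical masses -/

section

variable [Fintype B] [Fintype H] {G : MetricGraph V B H} {u : B ⊕ H → ℝ → ℝ}

lemma integral_nonneg {w : B ⊕ H → ℝ → ℝ} (hw : ∀ e x, 0 ≤ w e x) : 0 ≤ G.integral w :=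
  Finset.sum_nonneg fun e _ => setIntegral_nonneg (G.measurableSet_interval e) fun x _ => hw e x

lemma MemH1.integral_pow_six_le (hu : G.MemH1 u) {M : ℝ}
    (hM : ∀ e, ∀ x ∈ G.interval e, |u e x| ≤ M) :
    G.integral (fun e x => |u e x| ^ 6) ≤ M ^ 4 * G.integral (fun e x => |u e x| ^ 2) := by
  simp only [integral, Finset.mul_sum, sq_abs, Even.pow_abs (n := 6) (by decide)]
  refine Finset.sum_le_sum fun e _ => ?_
  rw [← integral_const_mul]
  refine setIntegral_mono_on ((hu.1 e).integrableOn_pow_six (G.measurableSet_interval e) (hM e))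
    ((hu.1 e).integrableOn_sq.const_mul _) (G.measurableSet_interval e) fun x hx => ?_
  have h4 := pow_le_pow_left₀ (abs_nonneg _) (hM e x hx) 4
  rw [Even.pow_abs (by decide)] at h4
  calc u e x ^ 6 = u e x ^ 4 * u e x ^ 2 := by ring
    _ ≤ _ := by gcongr

/-- A lower bound on the action gives the sign of the energy `∫ u'² - ∫ u⁶ / 3` for small masses. -/
lemma MemH1.integral_pow_six_le_of_le_sum (hu : G.MemH1 u) {M : ℝ}
    (hM : ∀ e, ∀ x ∈ G.interval e, |u e x| ≤ M) {μ : ℝ}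
    (hμ : G.integral (fun e x => |u e x| ^ 2) ≤ μ) {N : ℝ}
    (h : N ^ 4 * μ ≤ 3 * ∑ e, G.edgeAction u N e) :
    G.integral (fun e x => |u e x| ^ 6) ≤ 3 * G.integral (fun e x => |deriv (u e) x| ^ 2) := by
  rw [sum_edgeAction hu hM N] at h
  have : N ^ 4 * G.integral (fun e x => |u e x| ^ 2) ≤ N ^ 4 * μ := by gcongr
  linarith

lemma three_mul_div_sqrt_three (a b : ℝ) : 3 * (a / √3 * b) = a * (√3 * b) := by
  have h3 : (0 : ℝ) < √3 := by positivity
  have h3sq : √3 * √3 = (3 : ℝ) := Real.mul_self_sqrt (by norm_num)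
  field_simp
  linear_combination (-1 : ℝ) * a * b * h3sq

/-- Raising the amplitude by the factor `1 / √r` changes the action to first order in `1 - r` by the
mass `X` of the second path, while the loss on the first path is of order `(1 - r) ^ (3 / 2)`. -/
lemma le_sqrt_three_mul_discArea_add {r q X : ℝ} (hr0 : 0 < r) (hr1 : r < 1) (hq0 : 0 < q)
    (hr : √3 * √(1 - r ^ 2) ≤ q / 2) (hX : q ≤ X) :
    √3 * discArea 1 + (1 - r) * q / 2 ≤ √3 * discArea r + (1 - r ^ 2) * X := by
  have h6 := mul_le_mul_of_nonneg_left (discArea_one_sub_le hr0.le hr1.le) (Real.sqrt_nonneg 3)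
  have h7 := mul_le_mul_of_nonneg_left hr (by linarith : 0 ≤ 1 - r)
  have h8 : (1 - r) * q ≤ (1 - r ^ 2) * X := by
    have h9 : r ^ 2 ≤ r := by nlinarith
    exact mul_le_mul (by linarith) hX hq0.le (by linarith)
  linear_combination h6 + h7 + h8

/-- On a graph without terminal points and with two half-lines, the energy is nonnegative up to a
mass which is larger than the critical mass `√3 π / 4` of the half-line. -/
theorem exists_mass_gt (hG : G.Connected) (htip : ∀ v, ¬ G.IsTerminal v)
    (hH : 2 ≤ Fintype.card H) :
    ∃ μ, √3 * discArea 1 < μ ∧ ∀ u, G.MemH1 u → G.integral (fun e x => |u e x| ^ 2) ≤ μ →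
      G.integral (fun e x => |u e x| ^ 6) ≤
        3 * G.integral (fun e x => |deriv (u e) x| ^ 2) := by
  have hne : Nonempty H := Fintype.card_pos_iff.1 (by omega)
  have hA1 : 1 / 2 < discArea 1 := by
    rw [discArea_one]
    linarith [Real.pi_gt_three]
  set c₀ := √3 * discArea 1 with hc₀
  have hc₀pos : 0 < c₀ := by positivity
  obtain ⟨δ, hδ, hδlen⟩ : ∃ δ > 0, ∀ f, δ ≤ G.len f := by
    rcases isEmpty_or_nonempty B with hB | hB
    · exact ⟨1, one_pos, fun f => hB.elim f⟩
    · obtain ⟨f, hf⟩ := Finite.exists_min G.len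
      exact ⟨_, G.len_pos f, hf⟩
  set L := ∑ f, G.len f with hL
  have hL0 : 0 ≤ L := Finset.sum_nonneg fun f _ => (G.len_pos f).le
  -- below the height `√m`, a drop to half of the maximum on the compact part costs more than `∫ u⁶`
  set m := 3 / (32 * (L + 1) * c₀) with hm
  have hm0 : 0 < m := by positivity
  -- `q` is the least mass carried by the second path when the height is at least `√m`
  set q := m * δ / 8 with hq
  have hq0 : 0 < q := by positivity
  obtain ⟨r, hr0, hr1, hr⟩ : ∃ r : ℝ, 0 < r ∧ r < 1 ∧ √3 * √(1 - r ^ 2) ≤ q / 2 := by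
    set η := min (1 / 2) (q ^ 2 / 12) with hη
    have hη0 : 0 < η := by positivity
    have hη1 : η ≤ 1 / 2 := min_le_left _ _
    have hη2 : η ≤ q ^ 2 / 12 := min_le_right _ _
    refine ⟨√(1 - η), Real.sqrt_pos.2 (by linarith), ?_, ?_⟩
    · rw [Real.sqrt_lt' one_pos]
      linarith
    · rw [Real.sq_sqrt (by linarith), ← Real.sqrt_mul (by norm_num)]
      refine Real.sqrt_le_iff.2 ⟨by positivity, ?_⟩
      linarith
  set μ := c₀ + min (min (√3 / 8) c₀) ((1 - r) * q / 2) with hμ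
  have hμ1 : μ ≤ c₀ + √3 / 8 := by
    have : min (min (√3 / 8) c₀) ((1 - r) * q / 2) ≤ √3 / 8 :=
      (min_le_left _ _).trans (min_le_left _ _)
    linarith
  have hμ2 : μ ≤ 2 * c₀ := by
    have : min (min (√3 / 8) c₀) ((1 - r) * q / 2) ≤ c₀ :=
      (min_le_left _ _).trans (min_le_right _ _)
    linarith
  have hμ3 : μ ≤ c₀ + (1 - r) * q / 2 := by
    have : min (min (√3 / 8) c₀) ((1 - r) * q / 2) ≤ (1 - r) * q / 2 := min_le_right _ _
    linarith
  refine ⟨μ, ?_, fun u hu hmass => ?_⟩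
  · have h1r : 0 < 1 - r := by linarith
    have : 0 < min (min (√3 / 8) c₀) ((1 - r) * q / 2) := by positivity
    linarith
  obtain ⟨e, x, hx, hM⟩ := hu.exists_max
  obtain ⟨hu1, c, hcB, hcH⟩ := id hu
  have hD0 : 0 ≤ G.integral (fun e x => |deriv (u e) x| ^ 2) :=
    integral_nonneg fun _ _ => by positivity
  have h64 := hu.integral_pow_six_le hM
  obtain ⟨M, hxM⟩ : ∃ M, |u e x| = M := ⟨_, rfl⟩
  rw [hxM] at hM h64
  have hsq : u e x ^ 2 = M ^ 2 := by rw [← hxM, sq_abs]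
  rcases (hxM ▸ abs_nonneg (u e x) : 0 ≤ M).eq_or_lt with hM0 | hM0
  · rw [← hM0] at h64
    linarith
  have hM1 : M ^ 2 / M ^ 2 = 1 := div_self (by positivity)
  -- an excess `1 / 8` of the action with amplitude `M` suffices
  have hgain : M ^ 4 / √3 * (discArea 1 + 1 / 8) ≤ ∑ e, G.edgeAction u M e →
      G.integral (fun e x => |u e x| ^ 6) ≤
        3 * G.integral (fun e x => |deriv (u e) x| ^ 2) := by
    intro h
    refine hu.integral_pow_six_le_of_le_sum hM hmass (N := M) ?_
    have := mul_le_mul_of_nonneg_left h (by norm_num : (0 : ℝ) ≤ 3)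
    rw [three_mul_div_sqrt_three] at this
    refine le_trans (mul_le_mul_of_nonneg_left hμ1 (by positivity)) (le_trans (le_of_eq ?_) this)
    rw [hc₀]
    ring
  have hk : 0 ≤ M ^ 4 / √3 := by positivity
  rcases e with e | h
  swap
  · have h2 := two_mul_discArea_le_sum_edgeAction hG hH hu1 hM0 hM hcB hcH (h := h) hx
    rw [hsq, hM1] at h2
    exact hgain (le_trans (mul_le_mul_of_nonneg_left (by linarith) hk) h2)
  obtain ⟨h', hh'⟩ := exists_discArea_add_le_sum_edgeAction hG htip hH hu1 hM0 hM hcB hcH hx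
  rw [hsq, hM1] at hh'
  by_cases hhigh : M / 2 ≤ |c (G.origin h')|
  · refine hgain (le_trans (mul_le_mul_of_nonneg_left ?_ hk) hh')
    have : 1 / 4 ≤ c (G.origin h') ^ 2 / M ^ 2 := by
      rw [le_div_iff₀ (by positivity), ← sq_abs (c _)]
      have := pow_le_pow_left₀ (by positivity) hhigh 2
      linarith
    linarith [discArea_mono this, le_discArea_quarter]
  push Not at hhigh
  rcases le_or_gt (M ^ 2) m with hsmall | hlarge
  · have h1 := sq_le_sum_integral_deriv_sq hG hu1 hcB hx hxM hhigh.le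
    rw [← hL] at h1
    have h2 : ∑ f, ∫ x in Icc 0 (G.len f), deriv (u (Sum.inl f)) x ^ 2 ≤
        G.integral (fun e x => |deriv (u e) x| ^ 2) := by
      simp only [integral, Fintype.sum_sum_type, sq_abs]
      have : 0 ≤ ∑ h, ∫ x in G.interval (Sum.inr h), deriv (u (Sum.inr h)) x ^ 2 :=
        Finset.sum_nonneg fun h _ => MeasureTheory.integral_nonneg fun x => sq_nonneg _
      exact le_add_of_nonneg_right this
    set D := G.integral (fun e x => |deriv (u e) x| ^ 2)
    have h4 : M ^ 2 ≤ 16 * (L + 1) * D := by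
      calc M ^ 2 ≤ _ := h1
        _ ≤ 16 * L * D := by gcongr
        _ ≤ 16 * (L + 1) * D := by gcongr; linarith
    have h5 : M ^ 2 * (2 * c₀) ≤ 3 / (16 * (L + 1)) := by
      calc M ^ 2 * (2 * c₀) ≤ m * (2 * c₀) := by gcongr
        _ = _ := by rw [hm]; field_simp; norm_num
    calc _ ≤ M ^ 4 * G.integral (fun e x => |u e x| ^ 2) := h64
      _ ≤ M ^ 4 * (2 * c₀) := by gcongr; linarith
      _ = M ^ 2 * (M ^ 2 * (2 * c₀)) := by ring
      _ ≤ (16 * (L + 1) * D) * (3 / (16 * (L + 1))) := by gcongr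
      _ = 3 * D := by field_simp
  · rcases discArea_add_le_sum_edgeAction_or hG htip hu1 hM0 hM hcB hcH hδ hδlen hx hxM with
      hcase | hcase
    · exact hgain (le_trans (mul_le_mul_of_nonneg_left (by linarith) hk) hcase)
    · set N := M / √r with hN
      have hsr : 0 < √r := Real.sqrt_pos.2 hr0
      have hsr2 : √r ^ 2 = r := Real.sq_sqrt hr0.le
      have hMN : M ≤ N := by
        rw [hN, le_div_iff₀ hsr]
        have : √r ≤ 1 := Real.sqrt_le_one.2 hr1.le
        nlinarith
      have hN0 : 0 < N := by positivity
      have hN2 : M ^ 2 / N ^ 2 = r := by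
        rw [hN, div_pow, hsr2]
        field_simp
      have hN4 : M ^ 4 = r ^ 2 * N ^ 4 := by
        rw [div_eq_iff (by positivity)] at hN2
        calc M ^ 4 = (M ^ 2) ^ 2 := by ring
          _ = _ := by rw [hN2]; ring
      have hact := hcase N hMN
      rw [hN2] at hact
      refine hu.integral_pow_six_le_of_le_sum hM hmass (N := N) ?_
      have h5 := mul_le_mul_of_nonneg_left hact (by norm_num : (0 : ℝ) ≤ 3)
      rw [mul_add, three_mul_div_sqrt_three, hN4] at h5
      refine le_trans (le_trans (mul_le_mul_of_nonneg_left hμ3 (by positivity)) ?_) h5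
      have h11 : c₀ + (1 - r) * q / 2 ≤ √3 * discArea r + (1 - r ^ 2) * (M ^ 2 * δ / 8) :=
        le_sqrt_three_mul_discArea_add hr0 hr1 hq0 hr (by rw [hq]; gcongr)
      have := mul_le_mul_of_nonneg_left h11 (by positivity : 0 ≤ N ^ 4)
      refine this.trans (le_of_eq ?_)
      ring

/-! ### From masses to the Gagliardo–Nirenberg constant -/

/-- If the energy is nonnegative up to the mass `μ`, then `3 / μ ^ 2` is admissible in the
Gagliardo–Nirenberg inequality: multiply `u` by a constant to give it the mass `μ`. -/
lemma integral_pow_six_le_of_mass {μ : ℝ} (hμ0 : 0 < μ)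
    (hμ : ∀ u, G.MemH1 u → G.integral (fun e x => |u e x| ^ 2) ≤ μ →
      G.integral (fun e x => |u e x| ^ 6) ≤ 3 * G.integral (fun e x => |deriv (u e) x| ^ 2))
    (hu : G.MemH1 u) :
    G.integral (fun e x => |u e x| ^ 6) ≤ 3 / μ ^ 2 *
      G.integral (fun e x => |u e x| ^ 2) ^ 2 * G.integral (fun e x => |deriv (u e) x| ^ 2) := by
  have hscale : ∀ a, 0 < a → a ^ 2 * G.integral (fun e x => |u e x| ^ 2) ≤ μ →
      a ^ 4 * G.integral (fun e x => |u e x| ^ 6) ≤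
        3 * G.integral (fun e x => |deriv (u e) x| ^ 2) := by
    intro a ha hm
    have hpow : ∀ n : ℕ, G.integral (fun e x => |a * u e x| ^ n) =
        a ^ n * G.integral (fun e x => |u e x| ^ n) := by
      intro n
      simp only [integral, abs_mul, mul_pow, integral_const_mul, Finset.mul_sum, abs_of_pos ha]
    have hder : G.integral (fun e x => |deriv (fun x => a * u e x) x| ^ 2) =
        a ^ 2 * G.integral (fun e x => |deriv (u e) x| ^ 2) := by
      simp only [integral, deriv_const_mul_field, abs_mul, mul_pow, integral_const_mul,
        Finset.mul_sum, abs_of_pos ha]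
    have := hμ _ (hu.const_mul a) (by rwa [hpow])
    rw [hpow, hder] at this
    have ha2 : 0 < a ^ 2 := by positivity
    refine le_of_mul_le_mul_left ?_ ha2
    linarith
  have hm0 : 0 ≤ G.integral (fun e x => |u e x| ^ 2) := integral_nonneg fun _ _ => by positivity
  have hD0 : 0 ≤ G.integral (fun e x => |deriv (u e) x| ^ 2) :=
    integral_nonneg fun _ _ => by positivity
  set S := G.integral (fun e x => |u e x| ^ 6)
  set m := G.integral (fun e x => |u e x| ^ 2)
  set D := G.integral (fun e x => |deriv (u e) x| ^ 2)
  rcases hm0.eq_or_lt with hm | hm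
  · -- a function of mass `0` may be multiplied by arbitrarily large constants
    rw [← hm]
    by_contra! hS
    simp only [ne_eq, OfNat.ofNat_ne_zero, not_false_eq_true, zero_pow, mul_zero, zero_mul] at hS
    have h1 := hscale (√(√((3 * D + 1) / S))) (by positivity) (by rw [← hm]; simpa using hμ0.le)
    have h4 : √(√((3 * D + 1) / S)) ^ 4 = (3 * D + 1) / S := by
      calc √(√((3 * D + 1) / S)) ^ 4 = (√(√((3 * D + 1) / S)) ^ 2) ^ 2 := by ring
        _ = _ := by rw [Real.sq_sqrt (by positivity), Real.sq_sqrt (by positivity)]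
    rw [h4, div_mul_cancel₀ _ hS.ne'] at h1
    linarith
  · have h2 : √(μ / m) ^ 2 = μ / m := Real.sq_sqrt (by positivity)
    have h1 := hscale (√(μ / m)) (by positivity) (by rw [h2, div_mul_cancel₀ _ hm.ne'])
    have h4 : √(μ / m) ^ 4 = μ ^ 2 / m ^ 2 := by
      calc √(μ / m) ^ 4 = (√(μ / m) ^ 2) ^ 2 := by ring
        _ = _ := by rw [h2, div_pow]
    rw [h4, div_mul_eq_mul_div, div_le_iff₀ (by positivity)] at h1
    rw [div_mul_eq_mul_div, div_mul_eq_mul_div, le_div_iff₀ (by positivity)]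
    linarith

/-- The constant is bounded below by the quotient of any function for which the left-hand side of
the inequality does not vanish, as soon as some constant is admissible. -/
lemma div_le_gnConstant (hadm : ∃ K, 0 ≤ K ∧ ∀ u, G.MemH1 u →
      G.integral (fun e x => |u e x| ^ 6) ≤ K * G.integral (fun e x => |u e x| ^ 2) ^ 2 *
        G.integral (fun e x => |deriv (u e) x| ^ 2))
    (hu : G.MemH1 u) (hS : 0 < G.integral (fun e x => |u e x| ^ 6)) :
    0 < G.integral (fun e x => |u e x| ^ 2) ^ 2 * G.integral (fun e x => |deriv (u e) x| ^ 2) ∧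
    G.integral (fun e x => |u e x| ^ 6) / (G.integral (fun e x => |u e x| ^ 2) ^ 2 *
      G.integral (fun e x => |deriv (u e) x| ^ 2)) ≤ G.gnConstant := by
  obtain ⟨K, hK0, hK⟩ := hadm
  have hpos : 0 < G.integral (fun e x => |u e x| ^ 2) ^ 2 *
      G.integral (fun e x => |deriv (u e) x| ^ 2) := by
    have h1 := hS.trans_le (hK u hu)
    rw [mul_assoc] at h1
    exact pos_of_mul_pos_right h1 hK0
  refine ⟨hpos, le_csInf ⟨K, hK0, hK⟩ ?_⟩
  rintro K' ⟨-, hK'⟩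
  rw [div_le_iff₀ hpos, ← mul_assoc]
  exact hK' u hu

lemma gnConstant_le {K : ℝ} (hK0 : 0 ≤ K) (hK : ∀ u, G.MemH1 u →
      G.integral (fun e x => |u e x| ^ 6) ≤ K * G.integral (fun e x => |u e x| ^ 2) ^ 2 *
        G.integral (fun e x => |deriv (u e) x| ^ 2)) : G.gnConstant ≤ K :=
  csInf_le ⟨0, fun _ h => h.1⟩ ⟨hK0, hK⟩

end

end MetricGraph

/-! ### The half-soliton -/

/-- The profile `1 / √(cosh x)` of the half-soliton, the optimal function on the half-line. -/
noncomputable def soliton (x : ℝ) : ℝ := (√(Real.cosh x))⁻¹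

lemma soliton_sq (x : ℝ) : soliton x ^ 2 = (Real.cosh x)⁻¹ := by
  rw [soliton, inv_pow, Real.sq_sqrt (Real.cosh_pos x).le]

lemma soliton_pow_six (x : ℝ) : soliton x ^ 6 = (Real.cosh x ^ 3)⁻¹ := by
  calc soliton x ^ 6 = (soliton x ^ 2) ^ 3 := by ring
    _ = _ := by rw [soliton_sq, inv_pow]

lemma contDiff_soliton : ContDiff ℝ 1 soliton :=
  (Real.contDiff_cosh.sqrt fun x => (Real.cosh_pos x).ne').inv fun x =>
    (Real.sqrt_pos.2 (Real.cosh_pos x)).ne'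

lemma deriv_soliton_sq (x : ℝ) :
    deriv soliton x ^ 2 = ((Real.cosh x)⁻¹ - (Real.cosh x ^ 3)⁻¹) / 4 := by
  have hc := Real.cosh_pos x
  have hs : 0 < √(Real.cosh x) := Real.sqrt_pos.2 hc
  have h : HasDerivAt soliton _ x := ((Real.hasDerivAt_cosh x).sqrt hc.ne').inv hs.ne'
  have h2 := Real.sq_sqrt hc.le
  have h3 := Real.cosh_sq' x
  rw [h.deriv, div_pow, neg_sq, div_pow, mul_pow, h2]
  field_simp
  linear_combination (-4 : ℝ) * h3

lemma tendsto_sinh_atTop : Tendsto Real.sinh atTop atTop :=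
  Real.sinhOrderIso.tendsto_atTop

lemma tendsto_arctan_sinh :
    Tendsto (fun x => Real.arctan (Real.sinh x)) atTop (𝓝 (Real.pi / 2)) :=
  (tendsto_nhds_of_tendsto_nhdsWithin Real.tendsto_arctan_atTop).comp tendsto_sinh_atTop

lemma hasDerivAt_arctan_sinh (x : ℝ) :
    HasDerivAt (fun x => Real.arctan (Real.sinh x)) (Real.cosh x)⁻¹ x := by
  convert! (Real.hasDerivAt_sinh x).arctan using 1
  have := Real.cosh_pos x
  rw [← Real.cosh_sq']
  field_simp

lemma integrableOn_inv_cosh : IntegrableOn (fun x => (Real.cosh x)⁻¹) (Ioi 0) :=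
  integrableOn_Ioi_deriv_of_nonneg' (fun x _ => hasDerivAt_arctan_sinh x)
    (fun x _ => (inv_pos.2 (Real.cosh_pos x)).le) tendsto_arctan_sinh

lemma integral_inv_cosh : ∫ x in Ioi 0, (Real.cosh x)⁻¹ = Real.pi / 2 := by
  rw [integral_Ioi_of_hasDerivAt_of_nonneg' (fun x _ => hasDerivAt_arctan_sinh x)
    (fun x _ => (inv_pos.2 (Real.cosh_pos x)).le) tendsto_arctan_sinh]
  simp

lemma hasDerivAt_primitive_inv_cosh_pow_three (x : ℝ) :
    HasDerivAt (fun x => (Real.sinh x / Real.cosh x ^ 2 + Real.arctan (Real.sinh x)) / 2)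
      (Real.cosh x ^ 3)⁻¹ x := by
  have hc := Real.cosh_pos x
  have h1 := (((Real.hasDerivAt_sinh x).div ((Real.hasDerivAt_cosh x).pow 2)
    (pow_pos hc 2).ne').add (hasDerivAt_arctan_sinh x)).div_const 2
  convert! h1 using 1
  have h3 := Real.cosh_sq' x
  simp only [Pi.pow_apply]
  field_simp
  push_cast
  linear_combination (-2 * Real.cosh x) * h3

lemma tendsto_primitive_inv_cosh_pow_three :
    Tendsto (fun x => (Real.sinh x / Real.cosh x ^ 2 + Real.arctan (Real.sinh x)) / 2) atTop
      (𝓝 (Real.pi / 4)) := by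
  have h1 : Tendsto (fun x => (Real.sinh x)⁻¹) atTop (𝓝 0) :=
    tendsto_sinh_atTop.inv_tendsto_atTop
  have h2 : Tendsto (fun x => Real.sinh x / Real.cosh x ^ 2) atTop (𝓝 0) := by
    refine squeeze_zero' ?_ ?_ h1
    · filter_upwards [eventually_gt_atTop 0] with x hx
      have := Real.sinh_pos_iff.2 hx
      positivity
    · filter_upwards [eventually_gt_atTop 0] with x hx
      have := Real.sinh_pos_iff.2 hx
      have hc := Real.cosh_pos x
      rw [inv_eq_one_div, div_le_div_iff₀ (by positivity) this, Real.cosh_sq']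
      nlinarith
  convert (h2.add tendsto_arctan_sinh).div_const 2 using 2
  ring

lemma integrableOn_inv_cosh_pow_three : IntegrableOn (fun x => (Real.cosh x ^ 3)⁻¹) (Ioi 0) :=
  integrableOn_Ioi_deriv_of_nonneg' (fun x _ => hasDerivAt_primitive_inv_cosh_pow_three x)
    (fun x _ => (inv_pos.2 (pow_pos (Real.cosh_pos x) 3)).le) tendsto_primitive_inv_cosh_pow_three

lemma integral_inv_cosh_pow_three : ∫ x in Ioi 0, (Real.cosh x ^ 3)⁻¹ = Real.pi / 4 := by
  rw [integral_Ioi_of_hasDerivAt_of_nonneg' (fun x _ => hasDerivAt_primitive_inv_cosh_pow_three x)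
    (fun x _ => (inv_pos.2 (pow_pos (Real.cosh_pos x) 3)).le) tendsto_primitive_inv_cosh_pow_three]
  simp

/-- A `C¹` function is in `H¹` as soon as it is square integrable together with its derivative. -/
lemma ContDiff.memH1 {f : ℝ → ℝ} (hf : ContDiff ℝ 1 f) {I : Set ℝ}
    (h1 : IntegrableOn (fun x => f x ^ 2) I) (h2 : IntegrableOn (fun x => deriv f x ^ 2) I) :
    MemH1 I f :=
  ⟨fun _ _ => hf.contDiffOn.absolutelyContinuousOnInterval,
    (memLp_two_iff_integrable_sq hf.continuous.aestronglyMeasurable).2 h1,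
    (memLp_two_iff_integrable_sq (hf.continuous_deriv le_rfl).aestronglyMeasurable).2 h2⟩

lemma memH1_soliton : MemH1 (Ici 0) soliton := by
  refine contDiff_soliton.memH1 ?_ ?_
  · simp only [soliton_sq]
    rw [integrableOn_Ici_iff_integrableOn_Ioi]
    exact integrableOn_inv_cosh
  · simp only [deriv_soliton_sq]
    rw [integrableOn_Ici_iff_integrableOn_Ioi]
    exact (integrableOn_inv_cosh.sub integrableOn_inv_cosh_pow_three).div_const 4

namespace MetricGraph

/-! ### The critical masses -/

/-- On the half-line, the energy is nonnegative up to the mass `√3 π / 4`. -/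
theorem halfLine_integral_pow_six_le {u : Empty ⊕ Unit → ℝ → ℝ} (hu : halfLine.MemH1 u)
    (hm : halfLine.integral (fun e x => |u e x| ^ 2) ≤ √3 * discArea 1) :
    halfLine.integral (fun e x => |u e x| ^ 6) ≤
      3 * halfLine.integral (fun e x => |deriv (u e) x| ^ 2) := by
  obtain ⟨e, x, hx, hM⟩ := hu.exists_max
  obtain ⟨M, hxM⟩ : ∃ M, |u e x| = M := ⟨_, rfl⟩
  rw [hxM] at hM
  rcases (hxM ▸ abs_nonneg (u e x) : 0 ≤ M).eq_or_lt with hM0 | hM0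
  · have h6 := hu.integral_pow_six_le hM
    have hD : 0 ≤ halfLine.integral (fun e x => |deriv (u e) x| ^ 2) :=
      integral_nonneg fun _ _ => by positivity
    rw [← hM0] at h6
    linarith
  rcases e with e | h
  · exact e.elim
  refine hu.integral_pow_six_le_of_le_sum hM hm (N := M) ?_
  have h1 := (hu.1 (Sum.inr h)).discArea_le_setIntegral_Ici hM0 (hM (Sum.inr h)) hx
  rw [← sq_abs, hxM, div_self (by positivity)] at h1
  have h2 : ∫ z in Ici x, actionDensity M (u (Sum.inr h)) z ≤
      halfLine.edgeAction u M (Sum.inr h) := by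
    refine setIntegral_mono_set ((hu.1 (Sum.inr h)).integrableOn_actionDensity
      (halfLine.measurableSet_interval _) (hM _) M) ?_ (ae_of_all _ (Ici_subset_Ici.2 hx))
    rw [Filter.EventuallyLE, ae_restrict_iff' (halfLine.measurableSet_interval _)]
    exact ae_of_all _ fun z hz => actionDensity_nonneg (hM _ z hz)
  have h3 := Finset.single_le_sum (f := fun e => halfLine.edgeAction u M e)
    (fun e _ => edgeAction_nonneg hM e) (Finset.mem_univ (Sum.inr h))
  have h4 := mul_le_mul_of_nonneg_left (h1.trans (h2.trans h3)) (by norm_num : (0 : ℝ) ≤ 3)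
  rwa [three_mul_div_sqrt_three] at h4

/-- The half-soliton shows that `K = 3 / (√3 π / 4) ^ 2` is optimal on the half-line. -/
theorem le_gnConstant_halfLine : 3 / (√3 * discArea 1) ^ 2 ≤ halfLine.gnConstant := by
  have hint : ∀ w : Empty ⊕ Unit → ℝ → ℝ, halfLine.integral w =
      ∫ x in Ioi 0, w (Sum.inr ()) x := by
    intro w
    simp only [integral, Fintype.sum_sum_type, Finset.univ_eq_empty, Finset.sum_empty, zero_add,
      Finset.univ_unique, Finset.sum_singleton]
    exact integral_Ici_eq_integral_Ioi
  have hA : 0 < √3 * discArea 1 := by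
    rw [discArea_one]
    positivity
  have hu : halfLine.MemH1 fun _ => soliton := by
    refine ⟨?_, fun _ => soliton 0, fun e => e.elim, fun _ => rfl⟩
    rintro (e | h)
    · exact e.elim
    · exact memH1_soliton
  have h2 : halfLine.integral (fun _ x => |soliton x| ^ 2) = Real.pi / 2 := by
    rw [hint]
    simp only [sq_abs, soliton_sq, integral_inv_cosh]
  have h6 : halfLine.integral (fun _ x => |soliton x| ^ 6) = Real.pi / 4 := by
    rw [hint]
    simp only [Even.pow_abs (n := 6) (by decide), soliton_pow_six, integral_inv_cosh_pow_three]
  have hD : halfLine.integral (fun _ x => |deriv soliton x| ^ 2) = Real.pi / 16 := by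
    rw [hint]
    simp only [sq_abs, deriv_soliton_sq]
    rw [integral_div, integral_sub integrableOn_inv_cosh integrableOn_inv_cosh_pow_three,
      integral_inv_cosh, integral_inv_cosh_pow_three]
    ring
  have h := (div_le_gnConstant ⟨3 / (√3 * discArea 1) ^ 2, by positivity, fun u hu =>
    integral_pow_six_le_of_mass hA (fun u hu hm => halfLine_integral_pow_six_le hu hm) hu⟩ hu
    (by rw [h6]; positivity)).2
  rw [h2, h6, hD] at h
  refine le_trans (le_of_eq ?_) h
  have h3 : (√3) ^ 2 = (3 : ℝ) := Real.sq_sqrt (by norm_num)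
  rw [discArea_one, mul_pow, h3]
  have := Real.pi_pos
  field_simp
  norm_num

/-- A graph with a half-line carries a nonzero function in `H¹`. -/
theorem exists_memH1_integral_pos {V B H : Type*} [Fintype B] [Fintype H] [Nonempty H]
    (G : MetricGraph V B H) :
    ∃ u, G.MemH1 u ∧ 0 < G.integral (fun e x => |u e x| ^ 6) := by
  let f : ContDiffBump (2 : ℝ) := ⟨1 / 2, 1, by norm_num, by norm_num⟩
  have hf0 : ∀ x, x ≤ 1 → f x = 0 := fun x hx => f.zero_of_le_dist (by
    rw [Real.dist_eq, abs_sub_comm]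
    exact le_trans (by change (1 : ℝ) ≤ 2 - x; linarith) (le_abs_self _))
  have hfH : _root_.MemH1 (Ici 0) f := by
    have hcd : ContDiff ℝ 1 f := f.contDiff
    exact ⟨fun _ _ => hcd.contDiffOn.absolutelyContinuousOnInterval,
      (hcd.continuous.memLp_of_hasCompactSupport f.hasCompactSupport).restrict _,
      ((hcd.continuous_deriv le_rfl).memLp_of_hasCompactSupport f.hasCompactSupport.deriv).restrict
        _⟩
  have hpos : 0 < ∫ x in Ici 0, |f x| ^ 6 := by
    have hall : ∫ x in Ici 0, |f x| ^ 6 = ∫ x, |f x| ^ 6 := by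
      refine setIntegral_eq_integral_of_forall_compl_eq_zero fun x hx => ?_
      rw [mem_Ici, not_le] at hx
      rw [hf0 x (by linarith), abs_zero, zero_pow (by decide)]
    rw [hall]
    refine (f.continuous.abs.pow 6).integral_pos_of_hasCompactSupport_nonneg_nonzero (x := 2)
      (f.hasCompactSupport.comp_left (g := fun y : ℝ => |y| ^ 6) (by simp))
      (fun x => by positivity) ?_
    rw [f.one_of_mem_closedBall (Metric.mem_closedBall_self f.rIn_pos.le)]
    norm_num
  refine ⟨Sum.elim (fun _ _ => 0) fun _ => f, ⟨?_, fun _ => 0, fun e => ⟨rfl, rfl⟩,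
    fun h => hf0 0 zero_le_one⟩, ?_⟩
  · rintro (e | h)
    · exact (contDiff_const (c := (0 : ℝ))).memH1 (by simp) (by simp)
    · exact hfH
  · simp only [integral, Fintype.sum_sum_type, Sum.elim_inl, Sum.elim_inr]
    have h0 : ∑ e, ∫ _ in G.interval (Sum.inl e), |(0 : ℝ)| ^ 6 = 0 := by simp
    rw [h0, zero_add]
    exact Finset.sum_pos (fun h _ => hpos) Finset.univ_nonempty

end MetricGraph

theorem corollary3 {V B H : Type*} [Fintype V] [Fintype B] [Fintype H]
    (G : MetricGraph V B H) (hconn : G.Connected)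
    (htip : ∀ v : V, ¬ G.IsTerminal v)
    (hcyc : ¬ G.HasCycleCovering)
    (hhalf : 2 ≤ Fintype.card H) :
    MetricGraph.halfLine.criticalMass < G.criticalMass := by
  have hne : Nonempty H := Fintype.card_pos_iff.1 (by omega)
  have hA : 0 < √3 * discArea 1 := by
    rw [discArea_one]
    positivity
  obtain ⟨μ, hμ, hmass⟩ := MetricGraph.exists_mass_gt hconn htip hhalf
  have hμ0 : 0 < μ := hA.trans hμ
  have hadm : ∀ u, G.MemH1 u → G.integral (fun e x => |u e x| ^ 6) ≤ 3 / μ ^ 2 *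
      G.integral (fun e x => |u e x| ^ 2) ^ 2 * G.integral (fun e x => |deriv (u e) x| ^ 2) :=
    fun u hu => MetricGraph.integral_pow_six_le_of_mass hμ0 hmass hu
  have hle : G.gnConstant ≤ 3 / μ ^ 2 := MetricGraph.gnConstant_le (by positivity) hadm
  have hpos : 0 < G.gnConstant := by
    obtain ⟨u, hu, hS⟩ := G.exists_memH1_integral_pos
    obtain ⟨h1, h2⟩ := MetricGraph.div_le_gnConstant ⟨3 / μ ^ 2, by positivity, hadm⟩ hu hS
    exact (div_pos hS h1).trans_le h2
  have hlt : 3 / μ ^ 2 < 3 / (√3 * discArea 1) ^ 2 := by gcongr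
  have hK := (hle.trans_lt hlt).trans_le MetricGraph.le_gnConstant_halfLine
  exact Real.sqrt_lt_sqrt (div_nonneg (by norm_num) (hpos.trans hK).le)
    (div_lt_div_of_pos_left (by norm_num) hpos hK)
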